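/- Let $G$ be a group, let $n\ge 0$, and let $\delta(x,\bar y)$ be a relation on $G\times G^{n}$ which is (left) invariant, i.e. for all $\bar b\in G^{n}$ and $a\in G$ there is $\bar c\in G^{n}$ such that $\delta(ax,\bar b)\Leftrightarrow\delta(x,\bar c)$ for all $x\in G$, and stable, i.e. for some $k\ge 1$ there are no $a_1,\dots,a_k\in G$ and $\bar b_1,\dots,\bar b_k\in G^{n}$ such that $\delta(a_i,\bar b_j)$ holds if and only if $i\le j$. Let $\operatorname{Def}_\delta(G)$ be the Boolean algebra of subsets of $G$ generated by the sets $\{x\in G:\delta(x,\bar b)\}$, $\bar b\in G^{n}$ (it contains $\emptyset$ and $G$). A set $A\subseteq G$ is generic if finitely many left translates of $A$ cover $G$. A complete $\delta$-type is a maximal subset $p$ of $\operatorname{Def}_\delta(G)$ such that any finitely many members of $p$ have a common element in $G$; it is generic if all its members are generic. A $\delta$-Keisler measure is a finitely additive probability measure on $\operatorname{Def}_\delta(G)$. Let $M_\delta$ be the first-order structure expanding the group $G$ by the relation $\delta$. There is a unique equivalence relation $E_\delta$ on $G$ such that: $E_\delta$ is definable without parameters in $M_\delta$; it has finitely many classes,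 all in $\operatorname{Def}_\delta(G)$; it is $G$-invariant, i.e. $E_\delta(a,b)\Leftrightarrow E_\delta(ga,gb)$ for all $a,b,g\in G$; and two generic complete $\delta$-types are equal if and only if they contain the same $E_\delta$-class. Let $G^0_\delta$ be the $E_\delta$-class of the identity. Then: (i) $G^0_\delta$ is a subgroup of $G$ of finite index and belongs to $\operatorname{Def}_\delta(G)$, and the $E_\delta$-classes are precisely the left cosets of $G^0_\delta$. (ii) Each left coset of $G^0_\delta$ is a member of exactly one generic complete $\delta$-type. (iii) For every $\phi\in\operatorname{Def}_\delta(G)$ and every left coset $C$ of $G^0_\delta$, exactly one of $C\cap\phi$ and $C\setminus\phi$ is generic. (iv) For every $\phi\in\operatorname{Def}_\delta(G)$, if $Y$ is the union of those left cosets $C$ of $G^0_\delta$ for which $C\cap\phi$ is generic, then the symmetric difference $\phi\,\triangle\, Y$ is not generic. (v) $G^0_\delta$ is the smallest finite-index subgroup of $G$ that belongs to $\operatorname{Def}_\delta(G)$, i.e. it is contained in every other such subgroup. (vi) There is a unique left-invariant $\delta$-Keisler measure $\mu_\delta$ on $\operatorname{Def}_\delta(G)$, and for $\phi\in\operatorname{Def}_\delta(G)$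 we have $\mu_\delta(\phi)>0$ if and only if $\phi$ is generic. -/

import Mathlib

open scoped Pointwise

namespace LocalStable

/-- Function symbols of the language of groups. -/
inductive GroupFunc : ℕ → Type
  | one : GroupFunc 0
  | inv : GroupFunc 1
  | mul : GroupFunc 2

/-- One relation symbol `δ(x, y₁, …, yₙ)`, of arity `n + 1`. -/
inductive DeltaRel (n : ℕ) : ℕ → Type
  | delta : DeltaRel n (n + 1)

/-- The language of groups together with a relation symbol for `δ(x, ȳ)`, `|ȳ| = n`. -/
def deltaLanguage (n : ℕ) : FirstOrder.Language where
  Functions := GroupFunc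
  Relations := DeltaRel n

section

variable {G : Type*} [Group G] {n : ℕ} (δ : G → (Fin n → G) → Prop)

/-- The structure `M_δ`: the group `G` expanded by the relation `δ`. -/
@[reducible]
def deltaStructure : (deltaLanguage n).Structure G where
  funMap := fun f v => match f, v with
    | GroupFunc.one, _ => 1
    | GroupFunc.inv, v => (v 0)⁻¹
    | GroupFunc.mul, v => v 0 * v 1
  RelMap := fun r v => match r, v with
    | DeltaRel.delta, v => δ (v 0) (fun i => v i.succ)

/-- Left invariance of `δ(x, ȳ)`. -/
def IsLeftInvariantRel : Prop :=
  ∀ (b : Fin n → G) (a : G), ∃ c : Fin n → G, ∀ x : G, δ (a * x) b ↔ δ x c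

/-- `δ(x, ȳ)` is `k`-stable. -/
def IsKStable (k : ℕ) : Prop :=
  ¬ ∃ (a : Fin k → G) (b : Fin k → Fin n → G), ∀ i j, δ (a i) (b j) ↔ i ≤ j

/-- `δ(x, ȳ)` is stable. -/
def IsStable : Prop := ∃ k : ℕ, 1 ≤ k ∧ IsKStable δ k

/-- `Def_δ(G)`: the Boolean algebra of subsets of `G` that are finite Boolean combinations of
instances `δ(x, b̄)` (the empty set and `G` included). -/
def DefAlg : BooleanSubalgebra (Set G) :=
  BooleanSubalgebra.closure (Set.range fun b : Fin n → G => {x : G | δ x b})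

/-- A set is (left) generic if finitely many left translates of it cover `G`. -/
def IsGeneric (A : Set G) : Prop :=
  ∃ F : Finset G, (⋃ g ∈ F, g • A) = Set.univ

/-- Complete `δ`-types over `G`, as maximal finitely satisfiable sets of `δ`-definable sets. -/
def IsCompleteType (p : Set (Set G)) : Prop :=
  Maximal (fun q : Set (Set G) => q ⊆ (DefAlg δ : Set (Set G)) ∧
    ∀ F : Finset (Set G), (F : Set (Set G)) ⊆ q → (⋂₀ (F : Set (Set G))).Nonempty) p

/-- Generic complete `δ`-types. -/
def IsGenericType (p : Set (Set G)) : Prop :=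
  IsCompleteType δ p ∧ ∀ A ∈ p, IsGeneric A

/-- A binary relation on `G` is definable without parameters in the structure `M_δ`. -/
def IsEmptyDefinable (R : Set (G × G)) : Prop :=
  letI := deltaStructure δ
  (∅ : Set G).Definable₂ (deltaLanguage n) R

/-- `FER_δ`: the equivalence relations on `G` that are definable without parameters in `M_δ`, have
finitely many classes, and all of whose classes are `δ`-definable. -/
def IsFER (E : Setoid G) : Prop :=
  IsEmptyDefinable δ {z : G × G | E z.1 z.2} ∧
  E.classes.Finite ∧ ∀ C ∈ E.classes, C ∈ DefAlg δ

/-- The defining properties of the relation `E_δ`: it lies in `FER_δ`, it is `G`-invariant, and two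
generic `δ`-types are equal if and only if they contain the same class of it. -/
def IsEDelta (E : Setoid G) : Prop :=
  IsFER δ E ∧
  (∀ a b g : G, E a b ↔ E (g * a) (g * b)) ∧
  ∀ p q : Set (Set G), IsGenericType δ p → IsGenericType δ q →
    (p = q ↔ ∃ C ∈ E.classes, C ∈ p ∧ C ∈ q)

/-- A `δ`-Keisler measure: a finitely additive probability measure on `Def_δ(G)`. -/
def IsKeislerMeasure (μ : DefAlg δ → ℝ) : Prop :=
  (∀ A, 0 ≤ μ A) ∧ μ ⊤ = 1 ∧
  ∀ A B : DefAlg δ, Disjoint (A : Set G) (B : Set G) → μ (A ⊔ B) = μ A + μ B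

/-- Left invariance of a function on `Def_δ(G)`. -/
def IsLeftInvariantMeasure (μ : DefAlg δ → ℝ) : Prop :=
  ∀ (g : G) (A B : DefAlg δ), (B : Set G) = g • (A : Set G) → μ B = μ A

end

/-- The class of the identity; for `E = E_δ` this is the `δ`-connected component `G⁰_δ`. -/
def identityClass {G : Type*} [Group G] (E : Setoid G) : Set G := {x : G | E x 1}

end LocalStable

/-!
In ultrafilter terms, stability says that the limits of `δ` in its two variables may be
interchanged. Hence the limits of a stable relation along ultrafilters are themselves definable, so
over countably many parameters there are only countably many types, and no filter can be split
indefinitely by instances of `δ`. Splitting a minimal `G`-invariant filter as far as possible yields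
a complete type with finite `G`-orbit. Every finite index subgroup in the algebra contains the
normal core of its stabilizer, so there are finitely many such subgroups and a smallest one, `H`.

For `A` in the algebra, the translates of `A` have limits, along ultrafilters on `G`, that lie in
the algebra and have finite orbit; one of them differs from `A` by a non-generic set, and having
finite orbit it is a union of left cosets of `H`. Thus each coset of `H` carries exactly one generic
type. The argument that produced the finite orbit, applied to the conull filter of an invariant
measure, shows that sets of positive measure are generic; hence the measure is determined by
counting the cosets of `H` that meet `A` generically. Finally `H` is definable without parameters:
if `Ψ` is a definable family with `H` among its members, then `H` is the intersection of the right
stabilizers of index at most `[G : H]` of the members of `Ψ`.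
-/

namespace LocalStable

open Filter

/-- The double limit property of a binary relation: its limits along ultrafilters on both sides may
be interchanged. For a relation between subsets of a model this is stability inside that model. -/
def HasDoubleLimits {X Y : Type*} (R : X → Y → Prop) : Prop :=
  ∀ (U : Ultrafilter X) (V : Ultrafilter Y),
    (∀ᶠ x in U, ∀ᶠ y in V, R x y) ↔ ∀ᶠ y in V, ∀ᶠ x in U, R x y

/-- The Boolean algebra of subsets of `X` generated by the instances `{x | R x y}` of a relation
`R`; for the relation `δ` it is `DefAlg δ`. -/
def instanceAlgebra {X Y : Type*} (R : X → Y → Prop) : BooleanSubalgebra (Set X) :=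
  BooleanSubalgebra.closure (Set.range fun y => {x | R x y})

/-! ### Double limits -/

section DoubleLimits

variable {X Y : Type*} {R : X → Y → Prop}

theorem exists_half_graph {U : Ultrafilter X} {V : Ultrafilter Y}
    (hR : ∀ᶠ x in U, ∀ᶠ y in V, R x y) (hnR : ∀ᶠ y in V, ∀ᶠ x in U, ¬ R x y) :
    ∃ (a : ℕ → X) (b : ℕ → Y), ∀ i j, R (a i) (b j) ↔ i ≤ j := by
  obtain ⟨f, hf, hlt⟩ := exists_seq_of_forall_finset_exists
    (fun z : X × Y => (∀ᶠ y in V, R z.1 y) ∧ (∀ᶠ x in U, ¬ R x z.2) ∧ R z.1 z.2)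
    (fun z w => R z.1 w.2 ∧ ¬ R w.1 z.2) (by
      intro s hs
      have hx : ∀ᶠ x in U, ∀ z ∈ s, ¬ R x z.2 := s.eventually_all.2 fun z hz => (hs z hz).2.1
      obtain ⟨x, hxR, hxs⟩ := (hR.and hx).exists
      have hy : ∀ᶠ y in V, ∀ z ∈ s, R z.1 y := s.eventually_all.2 fun z hz => (hs z hz).1
      obtain ⟨y, ⟨hxy, hyR⟩, hys⟩ := ((hxR.and hnR).and hy).exists
      exact ⟨(x, y), ⟨hxR, hyR, hxy⟩, fun z hz => ⟨hys z hz, hxs z hz⟩⟩)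
  refine ⟨fun i => (f i).1, fun j => (f j).2, fun i j => ?_⟩
  rcases lt_trichotomy i j with h | rfl | h
  · exact iff_of_true (hlt i j h).1 h.le
  · exact iff_of_true (hf i).2.2 le_rfl
  · exact iff_of_false (hlt j i h).2 h.not_ge

theorem HasDoubleLimits.of_no_half_graph (k : ℕ)
    (h : ¬ ∃ (a : Fin k → X) (b : Fin k → Y), ∀ i j, R (a i) (b j) ↔ i ≤ j) :
    HasDoubleLimits R := by
  intro U V
  constructor <;> intro hlim <;> by_contra hne <;>
    simp only [← Ultrafilter.eventually_not] at hne
  · obtain ⟨a, b, hab⟩ := exists_half_graph hlim hne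
    exact h ⟨fun i => a i, fun j => b j, fun i j => by simp [hab]⟩
  · obtain ⟨a, b, hab⟩ := exists_half_graph (R := fun x y => ¬ R x y) hne
      (by simpa only [not_not] using hlim)
    -- Reversing both sequences of a half graph of `¬ R` makes it one of `R`; the shift by one
    -- turns the strict inequality into a weak one.
    refine h ⟨fun i => a (k - i), fun j => b (k - 1 - j), fun i j => ?_⟩
    rw [← not_iff_not, hab, Fin.le_def]
    lia

namespace HasDoubleLimits

theorem swap (h : HasDoubleLimits R) : HasDoubleLimits fun y x => R x y :=
  fun U V => (h V U).symm

theorem comp (h : HasDoubleLimits R) {X' Y' : Type*} (f : X' → X) (g : Y' → Y) :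
    HasDoubleLimits fun x y => R (f x) (g y) :=
  fun U V => h (U.map f) (V.map g)

theorem not (h : HasDoubleLimits R) : HasDoubleLimits fun x y => ¬ R x y := by
  intro U V
  simpa only [Ultrafilter.eventually_not] using not_congr (h U V)

theorem or (h : HasDoubleLimits R) {S : X → Y → Prop} (h' : HasDoubleLimits S) :
    HasDoubleLimits fun x y => R x y ∨ S x y := by
  intro U V
  simpa only [Ultrafilter.eventually_or] using or_congr (h U V) (h' U V)

end HasDoubleLimits

theorem mem_instanceAlgebra (R : X → Y → Prop) (y : Y) : {x | R x y} ∈ instanceAlgebra R :=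
  BooleanSubalgebra.subset_closure ⟨y, rfl⟩

end DoubleLimits

theorem IsStable.hasDoubleLimits {G : Type*} {n : ℕ} {δ : G → (Fin n → G) → Prop}
    (h : IsStable δ) : HasDoubleLimits δ :=
  have ⟨k, _, hk⟩ := h
  .of_no_half_graph k hk

section Ultrafilters

variable {X : Type*}

theorem exists_ultrafilter_le_principal_of_infClosed {F : Set (Set X)} (hF : F.Nonempty)
    (hinf : InfClosed F) {E : Set X} (hE : ∀ C ∈ F, (C ∩ E).Nonempty) :
    ∃ U : Ultrafilter X, E ∈ U ∧ ∀ C ∈ F, C ∈ U := by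
  let b : FilterBasis X := ⟨F, hF, fun hC hD => ⟨_, hinf hC hD, subset_rfl⟩⟩
  have : (b.filter ⊓ 𝓟 E).NeBot := b.hasBasis.inf_principal_neBot_iff.2 hE
  have hle : ↑(Ultrafilter.of (b.filter ⊓ 𝓟 E)) ≤ b.filter ⊓ 𝓟 E := Ultrafilter.of_le _
  exact ⟨_, le_principal_iff.1 (hle.trans inf_le_right),
    fun C hC => hle.trans inf_le_left (b.mem_filter_of_mem hC)⟩

theorem exists_ultrafilters_of_notMem {B : BooleanSubalgebra (Set X)} {D : Set X} (hD : D ∉ B) :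
    ∃ U V : Ultrafilter X, D ∈ U ∧ D ∉ V ∧ ∀ C ∈ B, C ∈ U ↔ C ∈ V := by
  obtain ⟨V, hVD, hV⟩ := exists_ultrafilter_le_principal_of_infClosed
    (F := {C | C ∈ B ∧ D ⊆ C}) (E := Dᶜ) ⟨_, B.top_mem, Set.subset_univ D⟩
    (fun C hC C' hC' => ⟨B.infClosed hC.1 hC'.1, Set.subset_inter hC.2 hC'.2⟩)
    fun C hC => Set.inter_compl_nonempty_iff.2 fun h => hD (h.antisymm hC.2 ▸ hC.1)
  obtain ⟨U, hUD, hU⟩ := exists_ultrafilter_le_principal_of_infClosed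
    (F := {C | C ∈ B ∧ C ∈ V}) (E := D) ⟨_, B.top_mem, univ_mem⟩
    (fun C hC C' hC' => ⟨B.infClosed hC.1 hC'.1, inter_mem hC.2 hC'.2⟩) fun C hC => by
      rw [← Set.not_disjoint_iff_nonempty_inter, ← Set.subset_compl_iff_disjoint_left]
      exact fun h => V.compl_notMem_iff.2 hC.2 (hV _ ⟨B.compl_mem hC.1, h⟩)
  refine ⟨U, V, hUD, V.compl_mem_iff_notMem.1 hVD,
    fun C hC => ⟨fun h => ?_, fun h => hU C ⟨hC, h⟩⟩⟩
  by_contra h'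
  exact U.compl_notMem_iff.2 h (hU _ ⟨B.compl_mem hC, V.compl_mem_iff_notMem.2 h'⟩)

/-- This is the definability of types over a model in which the relation is stable. -/
theorem HasDoubleLimits.limit_mem {Y : Type*} {R : X → Y → Prop} (h : HasDoubleLimits R)
    (U : Ultrafilter X) : {y | ∀ᶠ x in U, R x y} ∈ instanceAlgebra fun y x => R x y := by
  by_contra hD
  obtain ⟨V, W, hV, hW, hVW⟩ := exists_ultrafilters_of_notMem hD
  refine hW ((h U W).1 (((h U V).2 hV).mono fun x hx => ?_))
  exact (hVW _ (mem_instanceAlgebra (fun y x => R x y) x)).1 hx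

theorem countable_booleanSubalgebra_closure {s : Set (Set X)} (hs : s.Countable) :
    (BooleanSubalgebra.closure s : Set (Set X)).Countable := by
  refine (MeasureTheory.countable_generateSetAlgebra hs).mono fun A hA => ?_
  have halg := MeasureTheory.isSetAlgebra_generateSetAlgebra (𝒜 := s)
  induction hA using BooleanSubalgebra.closure_bot_sup_induction with
  | mem A hA => exact MeasureTheory.self_subset_generateSetAlgebra hA
  | bot => exact halg.empty_mem
  | sup A _ C _ hA hC => exact halg.union_mem hA hC
  | compl A _ hA => exact halg.compl_mem hA

theorem HasDoubleLimits.countable_limits {Y : Type*} [Countable X] {R : X → Y → Prop}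
    (h : HasDoubleLimits R) :
    (Set.range fun U : Ultrafilter X => {y | ∀ᶠ x in U, R x y}).Countable :=
  (countable_booleanSubalgebra_closure (Set.countable_range _)).mono
    (Set.range_subset_iff.2 h.limit_mem)

end Ultrafilters

section Tree

variable {X Y : Type*} {R : X → Y → Prop}

/-- The ultrafilter `U` concentrates on the initial segments of the branch `σ`. -/
theorem exists_ultrafilter_branch {C : List Bool → Set X} {b : List Bool → Y}
    {a : List Bool → X} (ha : ∀ s, a s ∈ C s) (hC : CantorScheme.Antitone C)
    (hb : ∀ s ε, ∀ x ∈ C (ε :: s), R x (b s) ↔ ε = true) (σ : ℕ → Bool) :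
    ∃ U : Ultrafilter (List Bool), ∀ m, (∀ᶠ s in U, R (a s) (b (PiNat.res σ m))) ↔ σ m = true := by
  have hanti : Antitone fun m => C (PiNat.res σ m) :=
    antitone_nat_of_succ_le fun m => hC _ _
  refine ⟨(hyperfilter ℕ).map (PiNat.res σ), fun m => ?_⟩
  have hev : ∀ᶠ i in hyperfilter ℕ, R (a (PiNat.res σ i)) (b (PiNat.res σ m)) ↔ σ m = true :=
    Nat.hyperfilter_le_atTop <| (eventually_gt_atTop m).mono fun i hi =>
      hb _ _ _ (hanti (Nat.succ_le_of_lt hi) (ha _))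
  rw [Ultrafilter.coe_map, eventually_map, eventually_congr hev, eventually_const]

theorem uncountable_nat_bool : Uncountable (ℕ → Bool) := by
  rw [← Cardinal.aleph0_lt_mk_iff]
  simpa using Cardinal.cantor Cardinal.aleph0

theorem HasDoubleLimits.not_binary_tree (h : HasDoubleLimits R) {C : List Bool → Set X}
    {b : List Bool → Y} (hne : ∀ s, (C s).Nonempty) (hC : CantorScheme.Antitone C)
    (hb : ∀ s ε, ∀ x ∈ C (ε :: s), R x (b s) ↔ ε = true) : False := by
  choose a ha using hne
  choose U hU using exists_ultrafilter_branch ha hC hb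
  let limit (V : Ultrafilter (List Bool)) : Set (List Bool) := {t | ∀ᶠ s in V, R (a s) (b t)}
  have hlimit (σ m) : PiNat.res σ m ∈ limit (U σ) ↔ σ m = true := hU σ m
  have hinj : Function.Injective fun σ => limit (U σ) := by
    intro σ τ (hστ : limit (U σ) = limit (U τ))
    refine PiNat.res_injective (funext fun m => ?_)
    induction m with
    | zero => rfl
    | succ m ih => rw [PiNat.res_succ, PiNat.res_succ, ih,
        Bool.eq_iff_iff.2 ((hlimit σ m).symm.trans (by rw [hστ, ih, hlimit]))]
  have hcount : (Set.range fun σ => limit (U σ)).Countable :=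
    (h.comp a b).countable_limits.mono (Set.range_comp_subset_range U limit)
  have := uncountable_nat_bool
  have := hcount.to_subtype
  exact not_countable (Set.rangeFactorization_injective.2 hinj).countable

end Tree

section Indivisible

variable {X Y : Type*} {R : X → Y → Prop}

/-- A filter decides a Boolean algebra of sets if the members of the algebra that it contains form
an ultrafilter of the algebra. -/
def Decides (F : Filter X) (B : BooleanSubalgebra (Set X)) : Prop := ∀ A ∈ B, A ∈ F ∨ Aᶜ ∈ F

theorem decides_instanceAlgebra {F : Filter X} (hF : ∀ y, {x | R x y} ∈ F ∨ {x | R x y}ᶜ ∈ F) :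
    Decides F (instanceAlgebra R) := by
  intro A hA
  induction hA using BooleanSubalgebra.closure_bot_sup_induction with
  | mem _ hA => obtain ⟨y, rfl⟩ := hA; exact hF y
  | bot => simp
  | sup A _ C _ hA hC =>
    rcases hA with hA | hA
    · exact .inl (mem_of_superset hA Set.subset_union_left)
    · exact hC.imp (mem_of_superset · Set.subset_union_right)
        fun hC => by simpa only [Set.sup_eq_union, Set.compl_union] using inter_mem hA hC
  | compl A _ hA => rwa [compl_compl, or_comm]

/-- Otherwise repeated splitting would grow a binary tree of instances. -/
theorem HasDoubleLimits.exists_decided (h : HasDoubleLimits R) (F : Filter X) [F.NeBot] :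
    ∃ C ∈ instanceAlgebra R, (F ⊓ 𝓟 C).NeBot ∧ Decides (F ⊓ 𝓟 C) (instanceAlgebra R) := by
  by_contra! hcon
  have hsplit : ∀ C ∈ instanceAlgebra R, (F ⊓ 𝓟 C).NeBot → ∃ y, ∀ ε : Bool,
      (F ⊓ 𝓟 (C ∩ {x | R x y ↔ ε = true})).NeBot := by
    intro C hC hFC
    by_contra! hy
    refine hcon C hC hFC (decides_instanceAlgebra fun y => ?_)
    obtain ⟨ε, hε⟩ := hy y
    rw [← inf_principal, ← inf_assoc, inf_principal_eq_bot] at hε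
    cases ε
    · exact .inl (by simpa [Set.compl_ofPred] using hε)
    · exact .inr (by simpa using hε)
  have : Nonempty Y := ⟨(hsplit _ (instanceAlgebra R).top_mem (by simpa)).choose⟩
  choose! b hb using hsplit
  let C (s : List Bool) : Set X := s.foldr (fun ε D => D ∩ {x | R x (b D) ↔ ε = true}) Set.univ
  have hC : ∀ s, C s ∈ instanceAlgebra R ∧ (F ⊓ 𝓟 (C s)).NeBot := by
    intro s
    induction s with
    | nil => exact ⟨(instanceAlgebra R).top_mem, by simpa [C]⟩
    | cons ε s ih =>
      refine ⟨(instanceAlgebra R).infClosed ih.1 ?_, hb _ ih.1 ih.2 ε⟩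
      cases ε
      · simpa [Set.compl_ofPred] using
          (instanceAlgebra R).compl_mem (mem_instanceAlgebra R (b (C s)))
      · simpa using mem_instanceAlgebra R (b (C s))
  exact h.not_binary_tree (C := C) (b := fun s => b (C s))
    (fun s => have := (hC s).2; nonempty_of_mem (mem_inf_of_right (f := F) (mem_principal_self _)))
    (fun s ε => Set.inter_subset_left) fun s ε x hx => hx.2

end Indivisible

/-! ### Types with finite orbit -/

section Action

open MulAction

variable {G X Y : Type*} [Group G] [MulAction G X]

/-- Invariance of a relation on a `G`-set: every translate of an instance is an instance. -/
def IsInvariantRel (G : Type*) {X Y : Type*} [SMul G X] (R : X → Y → Prop) : Prop :=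
  ∀ (g : G) (y : Y), ∃ y', ∀ x, R (g • x) y ↔ R x y'

/-- The part of a filter lying in a Boolean algebra of sets. Traces of ultrafilters are the
complete types. -/
def trace (B : BooleanSubalgebra (Set X)) (F : Filter X) : Set (Set X) := {A | A ∈ B ∧ A ∈ F}

theorem mem_smul_filter_iff {F : Filter X} {g : G} {A : Set X} : A ∈ g • F ↔ g⁻¹ • A ∈ F := by
  rw [mem_smul_filter, Set.preimage_smul]

theorem smul_mem_ultrafilter_iff {U : Ultrafilter X} {g : G} {A : Set X} :
    g • A ∈ U ↔ A ∈ U.map (g⁻¹ • ·) := by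
  rw [Ultrafilter.mem_map, Set.preimage_smul, inv_inv]

theorem smul_inf_principal (F : Filter X) (g : G) (C : Set X) :
    g • (F ⊓ 𝓟 C) = g • F ⊓ 𝓟 (g • C) := by
  simp only [← Filter.map_smul, Filter.map_inf (MulAction.injective g), map_principal,
    Set.image_smul]

theorem finiteIndex_stabilizer_iff {x : X} :
    (stabilizer G x).FiniteIndex ↔ (orbit G x).Finite := by
  rw [Subgroup.finiteIndex_iff, index_stabilizer]
  refine ⟨Set.finite_of_ncard_ne_zero, fun h => ?_⟩
  exact ((nonempty_orbit x).ncard_pos h).ne'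

theorem IsInvariantRel.smul_mem {R : X → Y → Prop} (hinv : IsInvariantRel G R) (g : G)
    {A : Set X} (hA : A ∈ instanceAlgebra R) : g • A ∈ instanceAlgebra R := by
  induction hA using BooleanSubalgebra.closure_bot_sup_induction with
  | mem _ hA =>
    obtain ⟨y, rfl⟩ := hA
    obtain ⟨y', hy'⟩ := hinv g⁻¹ y
    convert mem_instanceAlgebra R y' using 1
    ext x
    rw [Set.mem_smul_set_iff_inv_smul_mem]
    exact hy' x
  | bot =>
    rw [Set.bot_eq_empty, Set.smul_set_empty]
    exact (instanceAlgebra R).bot_mem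
  | sup A _ C _ hA hC =>
    change g • (A ∪ C) ∈ _
    rw [Set.smul_set_union]
    exact (instanceAlgebra R).supClosed hA hC
  | compl A _ hA =>
    rw [Set.smul_set_compl]
    exact (instanceAlgebra R).compl_mem hA

theorem smul_trace {B : BooleanSubalgebra (Set X)} (hB : ∀ g : G, ∀ A ∈ B, g • A ∈ B)
    (F : Filter X) (g : G) : g • trace B F = trace B (g • F) := by
  ext A
  rw [Set.mem_smul_set_iff_inv_smul_mem]
  refine and_congr ⟨fun h => ?_, hB _ A⟩ mem_smul_filter_iff.symm
  simpa using hB g _ h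

theorem Decides.trace_eq {B : BooleanSubalgebra (Set X)} {F F' : Filter X} (hF : Decides F B)
    (hF' : F' ≤ F) [F'.NeBot] : trace B F' = trace B F := by
  ext A
  refine and_congr_right fun hA => ⟨fun h => (hF A hA).resolve_right fun hc => ?_, fun h => hF' h⟩
  exact empty_notMem F' (by simpa using inter_mem h (hF' hc))

theorem Decides.smul {B : BooleanSubalgebra (Set X)} (hB : ∀ g : G, ∀ A ∈ B, g • A ∈ B)
    {F : Filter X} (hF : Decides F B) (g : G) : Decides (g • F) B := by
  intro A hA
  simpa only [mem_smul_filter_iff, Set.smul_set_compl] using hF _ (hB g⁻¹ A hA)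

section InvariantFilter

theorem disjoint_iInf_principal_compl_iff {F : Filter X} {C : Set X} :
    Disjoint F (⨅ g : G, 𝓟 (g • C)ᶜ) ↔ ∃ t : Set G, t.Finite ∧ (⋃ g ∈ t, g • C) ∈ F := by
  simp only [(hasBasis_iInf_principal_finite _).disjoint_iff_right, ← Set.compl_iUnion,
    compl_compl]

theorem smul_eq_of_forall_smul_le {F : Filter X} (hF : ∀ g : G, g • F ≤ F) (g : G) :
    g • F = F :=
  (hF g).antisymm (by simpa using smul_filter_le_smul_filter (a := g) (hF g⁻¹))

theorem exists_minimal_invariant_filter (G X : Type*) [Group G] [MulAction G X] [Nonempty X] :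
    ∃ F : Filter X, Minimal (fun F => F.NeBot ∧ ∀ g : G, g • F ≤ F) F := by
  obtain ⟨F, -, hF⟩ := zorn_le_nonempty₀ (α := (Filter X)ᵒᵈ)
    {F | (OrderDual.ofDual F).NeBot ∧ ∀ g : G, g • OrderDual.ofDual F ≤ OrderDual.ofDual F}
    (fun c hc hchain F hFc => by
      refine ⟨sInf (α := Filter X) c, ⟨?_, fun g => ?_⟩, fun F' => sInf_le (α := Filter X)⟩
      · exact sInf_neBot_of_directed' ⟨F, hFc⟩ hchain.directedOn
          fun hbot => (hc hbot).1.ne rfl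
      · exact le_sInf fun F' hF' => (smul_filter_le_smul_filter (sInf_le hF')).trans ((hc hF').2 g))
    (⊤ : Filter X) ⟨inferInstanceAs (⊤ : Filter X).NeBot, fun g => le_top⟩
  exact ⟨F, hF.1, fun F' hF' hle => hF.2 hF' hle⟩

theorem exists_finite_iUnion_smul_mem {F : Filter X}
    (hF : Minimal (fun F => F.NeBot ∧ ∀ g : G, g • F ≤ F) F) {C : Set X} (hC : (F ⊓ 𝓟 C).NeBot) :
    ∃ t : Set G, t.Finite ∧ (⋃ g ∈ t, g • C) ∈ F := by
  rw [← disjoint_iInf_principal_compl_iff]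
  by_contra hdisj
  let L : Filter X := ⨅ g : G, 𝓟 (g • C)ᶜ
  have hmem (g : G) : (g • C)ᶜ ∈ L := mem_iInf_of_mem g (mem_principal_self _)
  have hL (g : G) : g • L ≤ L := le_iInf fun h => by
    rw [le_principal_iff, mem_smul_filter_iff, Set.smul_set_compl, smul_smul]
    exact hmem _
  have hFL : F ≤ F ⊓ L := hF.2 ⟨⟨fun h => hdisj (disjoint_iff.2 h)⟩, fun g =>
    map_inf_le.trans (inf_le_inf (hF.1.2 g) (hL g))⟩ inf_le_left
  have hCF : Cᶜ ∈ F := by simpa using (hFL.trans inf_le_right) (hmem 1)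
  exact hC.ne (inf_principal_eq_bot.2 hCF)

end InvariantFilter

section FiniteOrbit

/-- Two translates of `C` that meet modulo `F` determine the same type. -/
theorem finite_orbit_trace {B : BooleanSubalgebra (Set X)} (hB : ∀ g : G, ∀ A ∈ B, g • A ∈ B)
    {F : Filter X} (hF : ∀ g : G, g • F ≤ F) {C : Set X} (hC : Decides (F ⊓ 𝓟 C) B)
    {t : Set G} (ht : t.Finite) (hmeet : ∀ g : G, ∃ k ∈ t, (F ⊓ 𝓟 (g • C ∩ k • C)).NeBot) :
    (orbit G (trace B (F ⊓ 𝓟 C))).Finite := by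
  have hsmul (g : G) : g • (F ⊓ 𝓟 C) = F ⊓ 𝓟 (g • C) := by
    rw [smul_inf_principal, smul_eq_of_forall_smul_le hF]
  have hdec (g : G) : Decides (F ⊓ 𝓟 (g • C)) B := hsmul g ▸ hC.smul hB g
  refine (ht.image (· • trace B (F ⊓ 𝓟 C))).subset ?_
  rintro _ ⟨g, rfl⟩
  obtain ⟨k, hk, hgk⟩ := hmeet g
  refine ⟨k, hk, ?_⟩
  simp only [smul_trace hB, hsmul]
  exact ((hdec k).trace_eq (inf_le_inf_left F (principal_mono.2 Set.inter_subset_right))).symm.trans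
    ((hdec g).trace_eq (inf_le_inf_left F (principal_mono.2 Set.inter_subset_left)))

theorem HasDoubleLimits.exists_finite_orbit [Nonempty X] {R : X → Y → Prop}
    (hR : HasDoubleLimits R) (hinv : IsInvariantRel G R) :
    ∃ U : Ultrafilter X, (orbit G (trace (instanceAlgebra R) U)).Finite := by
  obtain ⟨F, hF⟩ := exists_minimal_invariant_filter G X
  have := hF.1.1
  obtain ⟨C, -, hFC, hC⟩ := hR.exists_decided F
  obtain ⟨t, ht, htF⟩ := exists_finite_iUnion_smul_mem hF hFC
  refine ⟨Ultrafilter.of (F ⊓ 𝓟 C), ?_⟩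
  rw [Decides.trace_eq hC (Ultrafilter.of_le _)]
  refine finite_orbit_trace (fun g _ => hinv.smul_mem g) hF.1.2 hC ht fun g => ?_
  have : (F ⊓ 𝓟 (g • C)).NeBot := by
    rw [← smul_eq_of_forall_smul_le hF.1.2 g, ← smul_inf_principal]
    infer_instance
  let U := Ultrafilter.of (F ⊓ 𝓟 (g • C))
  have hU : ↑U ≤ F ⊓ 𝓟 (g • C) := Ultrafilter.of_le _
  obtain ⟨k, hk, hkU⟩ := (U.finite_biUnion_mem_iff ht).1 ((hU.trans inf_le_left) htF)
  refine ⟨k, hk, U.neBot'.mono (le_inf (hU.trans inf_le_left) (le_principal_iff.2 ?_))⟩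
  exact inter_mem (le_principal_iff.1 (hU.trans inf_le_right)) hkU

end FiniteOrbit

end Action

/-! ### Generic sets -/

section Generic

open MulAction

variable {G : Type*} [Group G] {A C : Set G}

theorem isGeneric_iff_exists_finite :
    IsGeneric A ↔ ∃ t : Set G, t.Finite ∧ ⋃ g ∈ t, g • A = Set.univ :=
  (Set.exists_finite_iff_finset (p := fun t => ⋃ g ∈ t, g • A = Set.univ)).symm

theorem isGeneric_iff_forall_ultrafilter :
    IsGeneric A ↔ ∀ U : Ultrafilter G, ∃ g : G, g • A ∈ U := by
  rw [isGeneric_iff_exists_finite]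
  constructor
  · rintro ⟨t, ht, htA⟩ U
    obtain ⟨g, -, hg⟩ := (U.finite_biUnion_mem_iff ht).1 (htA ▸ univ_mem)
    exact ⟨g, hg⟩
  · simp only [← mem_top, ← disjoint_iInf_principal_compl_iff, top_disjoint]
    intro h
    by_contra hne
    have : (⨅ g : G, 𝓟 (g • A)ᶜ).NeBot := ⟨hne⟩
    obtain ⟨g, hg⟩ := h (Ultrafilter.of (⨅ g : G, 𝓟 (g • A)ᶜ))
    exact Ultrafilter.compl_notMem_iff.2 hg
      (Ultrafilter.of_le _ (mem_iInf_of_mem g (mem_principal_self _)))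

theorem IsGeneric.mono (hA : IsGeneric A) (hAC : A ⊆ C) : IsGeneric C := by
  rw [isGeneric_iff_forall_ultrafilter] at hA ⊢
  exact fun U => (hA U).imp fun g hg => mem_of_superset hg (Set.smul_set_mono hAC)

@[simp]
theorem isGeneric_smul_iff {g : G} : IsGeneric (g • A) ↔ IsGeneric A := by
  simp only [isGeneric_iff_forall_ultrafilter, smul_smul]
  exact forall_congr' fun U => ((mul_right_surjective g).exists (p := (· • A ∈ U))).symm

theorem isGeneric_of_finite_orbit (hA : A.Nonempty) (horb : (orbit G A).Finite) :
    IsGeneric A := by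
  rw [isGeneric_iff_forall_ultrafilter]
  intro U
  have hcover : ⋃₀ orbit G A = Set.univ := by
    obtain ⟨a, ha⟩ := hA
    refine Set.eq_univ_of_forall fun x => ⟨_, mem_orbit A (x * a⁻¹), a, ha, ?_⟩
    simp
  obtain ⟨_, ⟨g, rfl⟩, hg⟩ := (U.finite_sUnion_mem_iff horb).1 (hcover ▸ univ_mem)
  exact ⟨g, hg⟩

theorem isGeneric_subgroup (H : Subgroup G) [H.FiniteIndex] : IsGeneric (H : Set G) := by
  refine isGeneric_of_finite_orbit ⟨1, H.one_mem⟩ (finiteIndex_stabilizer_iff.1 ?_)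
  rwa [stabilizer_subgroup]

end Generic

section LimitTranslates

open MulAction

variable {G X Y : Type*} [Group G] [MulAction G X] {R : X → Y → Prop}

/-- The limit of the translates `g • A` as `g` runs along an ultrafilter `U`. -/
def limitTranslates (U : Ultrafilter G) (A : Set X) : Set X := {x : X | ∀ᶠ g : G in U, x ∈ g • A}

theorem smul_limitTranslates (U : Ultrafilter G) (A : Set X) (h : G) :
    h • limitTranslates U A = limitTranslates (U.map (h * ·)) A := by
  ext x
  rw [Set.mem_smul_set_iff_inv_smul_mem]
  simp only [limitTranslates, Set.mem_ofPred_eq, Ultrafilter.coe_map, eventually_map,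
    Set.mem_smul_set_iff_inv_smul_mem, mul_inv_rev, smul_smul]

theorem HasDoubleLimits.mem_smul (hR : HasDoubleLimits R) (hinv : IsInvariantRel G R) {A : Set X}
    (hA : A ∈ instanceAlgebra R) : HasDoubleLimits fun (g : G) (x : X) => x ∈ g • A := by
  simp only [Set.mem_smul_set_iff_inv_smul_mem]
  induction hA using BooleanSubalgebra.closure_bot_sup_induction with
  | mem _ hA =>
    obtain ⟨y, rfl⟩ := hA
    choose c hc using fun g : G => hinv g⁻¹ y
    simp only [Set.mem_ofPred_eq, hc]
    exact (hR.comp id c).swap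
  | bot =>
    exact fun U V => by
      simp only [Set.bot_eq_empty, Set.mem_empty_iff_false, eventually_const]
  | sup _ _ _ _ hA hC => exact hA.or hC
  | compl _ _ hA => exact hA.not

theorem limitTranslates_mem_instanceAlgebra (hR : HasDoubleLimits R) (hinv : IsInvariantRel G R)
    {A : Set X} (hA : A ∈ instanceAlgebra R) (U : Ultrafilter G) :
    limitTranslates U A ∈ instanceAlgebra R := by
  refine BooleanSubalgebra.closure_le.2 ?_ ((hR.mem_smul hinv hA).limit_mem U)
  rintro _ ⟨g, rfl⟩
  exact hinv.smul_mem g hA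

theorem smul_limitTranslates_mem_iff (hR : HasDoubleLimits R) (hinv : IsInvariantRel G R)
    {A : Set X} (hA : A ∈ instanceAlgebra R) (U : Ultrafilter G) (V : Ultrafilter X) (h : G) :
    h • limitTranslates U A ∈ V ↔ ∀ᶠ g in U, (h * g) • A ∈ V := by
  rw [smul_limitTranslates]
  exact (hR.mem_smul hinv hA (U.map (h * ·)) V).symm

theorem exists_finite_orbit_limitTranslates (hR : HasDoubleLimits R) (hinv : IsInvariantRel G R)
    {A : Set X} (hA : A ∈ instanceAlgebra R) :
    ∃ U : Ultrafilter G, (orbit G (limitTranslates U A)).Finite := by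
  let S (g : G) (x : X) : Prop := x ∈ g • A
  have hS : IsInvariantRel G S := fun h x => ⟨h⁻¹ • x, fun g => by
    simp only [S, Set.mem_smul_set_iff_inv_smul_mem, smul_eq_mul, mul_inv_rev, smul_smul]⟩
  have hSR : HasDoubleLimits S := hR.mem_smul hinv hA
  obtain ⟨U, hU⟩ := hSR.exists_finite_orbit hS
  refine ⟨U, (hU.image fun p => {x | {g | S g x} ∈ p}).subset ?_⟩
  rintro _ ⟨h, rfl⟩
  refine ⟨_, mem_orbit _ h, ?_⟩
  ext x
  simp only [smul_trace fun g _ => hS.smul_mem g, smul_limitTranslates]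
  exact and_iff_right (mem_instanceAlgebra S x)

end LimitTranslates

section Approximation

open MulAction

variable {G Y : Type*} [Group G] {R : G → Y → Prop} {A : Set G} {V : Ultrafilter G}

theorem IsGeneric.of_limitTranslates (hR : HasDoubleLimits R) (hinv : IsInvariantRel G R)
    (hA : A ∈ instanceAlgebra R) {U : Ultrafilter G} (h : IsGeneric (limitTranslates U A)) :
    IsGeneric A := by
  rw [isGeneric_iff_forall_ultrafilter] at h ⊢
  intro W
  obtain ⟨k, hk⟩ := h W
  exact ((smul_limitTranslates_mem_iff hR hinv hA U W k).1 hk).exists.imp' (k * ·) fun _ => id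

/-- An ultrafilter concentrates on a coset of a finite index subgroup acting trivially on the orbit
of the type of `V`, so the limit of the translates of `A` looks to `V` like a single translate. -/
theorem exists_smul_limitTranslates_mem_iff (hR : HasDoubleLimits R) (hinv : IsInvariantRel G R)
    (hA : A ∈ instanceAlgebra R) (hV : (orbit G (trace (instanceAlgebra R) V)).Finite)
    (U : Ultrafilter G) :
    ∃ k : G, ∀ h : G, h • limitTranslates U A ∈ V ↔ (h * k) • A ∈ V := by
  let p := trace (instanceAlgebra R) V
  have hp (g : G) : g • A ∈ p ↔ g • A ∈ V := and_iff_right (hinv.smul_mem g hA)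
  have : (stabilizer G p).FiniteIndex := finiteIndex_stabilizer_iff.2 hV
  obtain ⟨k, hk⟩ :=
    isGeneric_iff_forall_ultrafilter.1 (isGeneric_subgroup (stabilizer G p).normalCore) U
  refine ⟨k, fun h => ?_⟩
  rw [smul_limitTranslates_mem_iff hR hinv hA]
  refine (eventually_congr (mem_of_superset hk ?_)).trans eventually_const
  rintro _ ⟨n, hn, rfl⟩
  have hconj : (h * k) * n * (h * k)⁻¹ ∈ stabilizer G p :=
    (stabilizer G p).normalCore_le (Subgroup.Normal.conj_mem inferInstance n hn (h * k))
  simpa [hp, smul_smul, mul_assoc] using mem_stabilizer_set.1 hconj ((h * k) • A)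

theorem isGeneric_of_mem (hR : HasDoubleLimits R) (hinv : IsInvariantRel G R)
    (hV : (orbit G (trace (instanceAlgebra R) V)).Finite) (hA : A ∈ instanceAlgebra R)
    (hAV : A ∈ V) : IsGeneric A := by
  obtain ⟨U, hU⟩ := exists_finite_orbit_limitTranslates hR hinv hA
  obtain ⟨k, hk⟩ := exists_smul_limitTranslates_mem_iff hR hinv hA hV U
  have hne : (limitTranslates U A).Nonempty :=
    Set.smul_set_nonempty.1 (Ultrafilter.nonempty_of_mem ((hk k⁻¹).2 (by simpa using hAV)))
  exact (isGeneric_of_finite_orbit hne hU).of_limitTranslates hR hinv hA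

theorem isGeneric_iff_exists_smul_mem (hR : HasDoubleLimits R) (hinv : IsInvariantRel G R)
    (hV : (orbit G (trace (instanceAlgebra R) V)).Finite) (hA : A ∈ instanceAlgebra R) :
    IsGeneric A ↔ ∃ g : G, g • A ∈ V :=
  ⟨fun h => isGeneric_iff_forall_ultrafilter.1 h V, fun ⟨g, hg⟩ =>
    isGeneric_smul_iff.1 (isGeneric_of_mem hR hinv hV (hinv.smul_mem g hA) hg)⟩

theorem isGeneric_union_iff (hR : HasDoubleLimits R) (hinv : IsInvariantRel G R) {A C : Set G}
    (hA : A ∈ instanceAlgebra R) (hC : C ∈ instanceAlgebra R) :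
    IsGeneric (A ∪ C) ↔ IsGeneric A ∨ IsGeneric C := by
  obtain ⟨V, hV⟩ := hR.exists_finite_orbit hinv
  have hAC : A ∪ C ∈ instanceAlgebra R := (instanceAlgebra R).supClosed hA hC
  simp only [isGeneric_iff_exists_smul_mem hR hinv hV hA,
    isGeneric_iff_exists_smul_mem hR hinv hV hC, isGeneric_iff_exists_smul_mem hR hinv hV hAC,
    Set.smul_set_union, Ultrafilter.union_mem_iff, exists_or]

theorem exists_finite_orbit_symmDiff_not_isGeneric (hR : HasDoubleLimits R)
    (hinv : IsInvariantRel G R) (hA : A ∈ instanceAlgebra R) :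
    ∃ A' ∈ instanceAlgebra R, (orbit G A').Finite ∧ ¬ IsGeneric (symmDiff A A') := by
  obtain ⟨V, hV⟩ := hR.exists_finite_orbit hinv
  obtain ⟨U, hU⟩ := exists_finite_orbit_limitTranslates hR hinv hA
  obtain ⟨k, hk⟩ := exists_smul_limitTranslates_mem_iff hR hinv hA hV U
  let A' := k⁻¹ • limitTranslates U A
  have hA' : A' ∈ instanceAlgebra R :=
    hinv.smul_mem _ (limitTranslates_mem_instanceAlgebra hR hinv hA U)
  refine ⟨A', hA', by rwa [orbit_smul], ?_⟩
  have hsymm : symmDiff A A' ∈ instanceAlgebra R := (instanceAlgebra R).supClosed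
    ((instanceAlgebra R).sdiff_mem hA hA') ((instanceAlgebra R).sdiff_mem hA' hA)
  rw [isGeneric_iff_exists_smul_mem hR hinv hV hsymm]
  rintro ⟨g, hg⟩
  have hgA : g • A ∈ V ↔ g • A' ∈ V := by simp [A', smul_smul, hk]
  simp [symmDiff_def, Set.smul_set_union, Set.smul_set_sdiff, Ultrafilter.sdiff_mem_iff, hgA] at hg

end Approximation

/-! ### The connected component -/

section Component

open MulAction MulOpposite

variable {G Y : Type*} [Group G] {R : G → Y → Prop} {A : Set G}

/-- The connected component of a relation: the smallest finite index subgroup in the algebra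
generated by its instances. -/
def IsComponent (R : G → Y → Prop) (H : Subgroup G) : Prop :=
  IsLeast {K : Subgroup G | K.FiniteIndex ∧ (K : Set G) ∈ instanceAlgebra R} H

theorem normalCore_stabilizer_trace_le (hinv : IsInvariantRel G R) (V : Ultrafilter G)
    (H : Subgroup G) [H.FiniteIndex] (hH : (H : Set G) ∈ instanceAlgebra R) :
    (stabilizer G (trace (instanceAlgebra R) V)).normalCore ≤ H := by
  intro m hm
  obtain ⟨g, hg⟩ := isGeneric_iff_forall_ultrafilter.1 (isGeneric_subgroup H) V
  have hconj : g * m * g⁻¹ ∈ stabilizer G (trace (instanceAlgebra R) V) :=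
    Subgroup.normalCore_le _ (Subgroup.Normal.conj_mem inferInstance m hm g)
  have hgm : (g * m) • (H : Set G) ∈ V := by
    have hiff := mem_stabilizer_set.1 hconj (g • (H : Set G))
    rw [smul_smul, inv_mul_cancel_right] at hiff
    exact (hiff.2 ⟨hinv.smul_mem g hH, hg⟩).2
  obtain ⟨_, ⟨a, ha, rfl⟩, b, hb, hab⟩ := Ultrafilter.nonempty_of_mem (inter_mem hg hgm)
  have : m = a * b⁻¹ := by
    rw [eq_mul_inv_iff_mul_eq]
    simpa [mul_assoc] using hab
  exact this ▸ H.mul_mem ha (H.inv_mem hb)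

theorem HasDoubleLimits.exists_isComponent (hR : HasDoubleLimits R)
    (hinv : IsInvariantRel G R) : ∃ H : Subgroup G, IsComponent R H := by
  obtain ⟨V, hV⟩ := hR.exists_finite_orbit hinv
  let N := (stabilizer G (trace (instanceAlgebra R) V)).normalCore
  have : (stabilizer G (trace (instanceAlgebra R) V)).FiniteIndex := finiteIndex_stabilizer_iff.2 hV
  let S := {K : Subgroup G | K.FiniteIndex ∧ (K : Set G) ∈ instanceAlgebra R}
  have hS : S.Finite := by
    have : {K | N ≤ K}.Finite := Finite.of_equiv _ (QuotientGroup.comapMk'OrderIso N).toEquiv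
    exact this.subset fun K ⟨_, hK⟩ => normalCore_stabilizer_trace_le hinv V K hK
  obtain ⟨H, hH⟩ := hS.exists_minimal ⟨⊤, inferInstance, (instanceAlgebra R).top_mem⟩
  refine ⟨H, hH.1, fun K hK => ?_⟩
  have hHK : H ⊓ K ∈ S := by
    have := hH.1.1
    have := hK.1
    exact ⟨inferInstance, (instanceAlgebra R).infClosed hH.1.2 hK.2⟩
  exact (hH.2 hHK inf_le_left).trans inf_le_right

/-- The subgroup of all `y` with `A * y = A`. -/
def rightStabilizer (A : Set G) : Subgroup G := (stabilizer Gᵐᵒᵖ A).unop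

theorem mem_rightStabilizer {y : G} : y ∈ rightStabilizer A ↔ ∀ x, x * y ∈ A ↔ x ∈ A :=
  mem_stabilizer_set

theorem finiteIndex_rightStabilizer_iff :
    (rightStabilizer A).FiniteIndex ↔ (orbit G A).Finite := by
  rw [← finiteIndex_stabilizer_iff]
  constructor <;> intro h
  · refine Subgroup.finiteIndex_of_le (H := (rightStabilizer A).normalCore) fun m hm =>
      mem_stabilizer_set.2 fun x => ?_
    have hconj : x⁻¹ * m * x ∈ rightStabilizer A := by
      simpa using Subgroup.normalCore_le _ (Subgroup.Normal.conj_mem inferInstance m hm x⁻¹)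
    simpa [mul_assoc] using mem_rightStabilizer.1 hconj x
  · refine Subgroup.finiteIndex_of_le (H := (stabilizer G A).normalCore) fun m hm =>
      mem_rightStabilizer.2 fun x => ?_
    have hconj : x * m * x⁻¹ ∈ stabilizer G A :=
      Subgroup.normalCore_le _ (Subgroup.Normal.conj_mem inferInstance m hm x)
    simpa using mem_stabilizer_set.1 hconj x

@[simp]
theorem rightStabilizer_coe (H : Subgroup G) : rightStabilizer (H : Set G) = H := by
  ext y
  refine mem_rightStabilizer.trans ⟨fun h => ?_, fun h x => H.mul_mem_cancel_right h⟩
  simpa using (h 1).2 H.one_mem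

theorem rightStabilizer_eq_iInter (A : Set G) :
    (rightStabilizer A : Set G) = ⋂ C ∈ orbit G A, {y | y ∈ C ↔ 1 ∈ C} := by
  ext y
  simp only [SetLike.mem_coe, mem_rightStabilizer, Set.mem_iInter, orbit, Set.forall_mem_range,
    Set.mem_ofPred_eq, Set.mem_smul_set_iff_inv_smul_mem, smul_eq_mul, mul_one]
  exact inv_surjective.forall

theorem rightStabilizer_mem_instanceAlgebra (hinv : IsInvariantRel G R)
    (hA : A ∈ instanceAlgebra R) [hfin : (rightStabilizer A).FiniteIndex] :
    (rightStabilizer A : Set G) ∈ instanceAlgebra R := by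
  rw [rightStabilizer_eq_iInter]
  refine (instanceAlgebra R).infClosed.biInf_mem (finiteIndex_rightStabilizer_iff.1 hfin) ?_ ?_
  · exact (instanceAlgebra R).top_mem
  rintro _ ⟨g, rfl⟩
  by_cases h1 : 1 ∈ g • A
  · simpa [h1] using hinv.smul_mem g hA
  · simp only [h1, iff_false]
    exact (instanceAlgebra R).compl_mem (hinv.smul_mem g hA)

theorem IsComponent.le_rightStabilizer {H : Subgroup G} (hH : IsComponent R H)
    (hinv : IsInvariantRel G R) (hA : A ∈ instanceAlgebra R) [(rightStabilizer A).FiniteIndex] :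
    H ≤ rightStabilizer A :=
  hH.2 ⟨inferInstance, rightStabilizer_mem_instanceAlgebra hinv hA⟩

end Component

section Cosets

open MulAction

variable {G Y : Type*} [Group G] {R : G → Y → Prop} {H : Subgroup G} {A C : Set G}

theorem IsComponent.exists_symmDiff_not_isGeneric (hH : IsComponent R H) (hR : HasDoubleLimits R)
    (hinv : IsInvariantRel G R) (hA : A ∈ instanceAlgebra R) :
    ∃ C : Set G, (∀ x, ∀ h ∈ H, x * h ∈ C ↔ x ∈ C) ∧ ¬ IsGeneric (symmDiff A C) := by
  obtain ⟨C, hC, horb, hAC⟩ := exists_finite_orbit_symmDiff_not_isGeneric hR hinv hA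
  have := finiteIndex_rightStabilizer_iff.2 horb
  exact ⟨C, fun x h hh => mem_rightStabilizer.1 (hH.le_rightStabilizer hinv hC hh) x, hAC⟩

theorem mem_iff_of_mem_smul_subgroup (hC : ∀ x, ∀ h ∈ H, x * h ∈ C ↔ x ∈ C) {g x : G}
    (hx : x ∈ g • (H : Set G)) : x ∈ C ↔ g ∈ C := by
  obtain ⟨h, hh, rfl⟩ := hx
  exact hC g h hh

theorem isGeneric_smul_subgroup_inter_iff (hR : HasDoubleLimits R) (hinv : IsInvariantRel G R)
    [H.FiniteIndex] (hH : (H : Set G) ∈ instanceAlgebra R) (hA : A ∈ instanceAlgebra R)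
    (hC : ∀ x, ∀ h ∈ H, x * h ∈ C ↔ x ∈ C) (hAC : ¬ IsGeneric (symmDiff A C)) (g : G) :
    IsGeneric (g • (H : Set G) ∩ A) ↔ g ∈ C := by
  constructor
  · intro hgen
    by_contra hg
    refine hAC (hgen.mono fun x hx => Or.inl ⟨hx.2, ?_⟩)
    rwa [mem_iff_of_mem_smul_subgroup hC hx.1]
  · intro hg
    have hgH := hinv.smul_mem g hH
    have hunion : IsGeneric (g • (H : Set G) ∩ A) ∨ IsGeneric (g • (H : Set G) \ A) := by
      refine (isGeneric_union_iff hR hinv ((instanceAlgebra R).infClosed hgH hA)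
        ((instanceAlgebra R).sdiff_mem hgH hA)).1 ?_
      change IsGeneric (g • (H : Set G) ∩ A ∪ g • (H : Set G) \ A)
      rw [Set.inter_union_sdiff, isGeneric_smul_iff]
      exact isGeneric_subgroup H
    refine hunion.resolve_right fun hgen => hAC (hgen.mono fun x hx => Or.inr ⟨?_, hx.2⟩)
    rwa [mem_iff_of_mem_smul_subgroup hC hx.1]

theorem IsComponent.xor_isGeneric (hH : IsComponent R H) (hR : HasDoubleLimits R)
    (hinv : IsInvariantRel G R) (hA : A ∈ instanceAlgebra R) (g : G) :
    Xor (IsGeneric (g • (H : Set G) ∩ A)) (IsGeneric (g • (H : Set G) \ A)) := by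
  have := hH.1.1
  obtain ⟨C, hC, hAC⟩ := hH.exists_symmDiff_not_isGeneric hR hinv hA
  rw [Set.sdiff_eq, isGeneric_smul_subgroup_inter_iff hR hinv hH.1.2 hA hC hAC,
    isGeneric_smul_subgroup_inter_iff (C := Cᶜ) hR hinv hH.1.2 ((instanceAlgebra R).compl_mem hA)
      (fun x h hh => not_congr (hC x h hh)) (by rwa [compl_symmDiff_compl]), xor_iff_not_iff']
  rfl

/-- The left cosets of `H` meeting `A` in a generic set. If `H` is the component, their union is
the approximation of `A` by cosets. -/
def genericCosets (H : Subgroup G) (A : Set G) : Set (Set G) :=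
  {C | (∃ g : G, C = g • (H : Set G)) ∧ IsGeneric (C ∩ A)}

theorem IsComponent.not_isGeneric_symmDiff (hH : IsComponent R H) (hR : HasDoubleLimits R)
    (hinv : IsInvariantRel G R) (hA : A ∈ instanceAlgebra R) :
    ¬ IsGeneric (symmDiff A (⋃₀ genericCosets H A)) := by
  have := hH.1.1
  obtain ⟨C, hC, hAC⟩ := hH.exists_symmDiff_not_isGeneric hR hinv hA
  have hiff := isGeneric_smul_subgroup_inter_iff hR hinv hH.1.2 hA hC hAC
  convert hAC using 3
  ext x
  constructor
  · rintro ⟨_, ⟨⟨g, rfl⟩, hg⟩, hx⟩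
    exact (mem_iff_of_mem_smul_subgroup hC hx).2 ((hiff g).1 hg)
  · exact fun hx => ⟨_, ⟨⟨x, rfl⟩, (hiff x).2 hx⟩, 1, H.one_mem, mul_one x⟩

end Cosets

section Types

variable {G : Type*} {n : ℕ} {δ : G → (Fin n → G) → Prop} {p q : Set (Set G)}

theorem isCompleteType_trace (W : Ultrafilter G) : IsCompleteType δ (trace (DefAlg δ) W) := by
  refine ⟨⟨fun A hA => hA.1, fun F hF => ?_⟩, fun q ⟨hq, hfip⟩ hle A hA => ⟨hq hA, ?_⟩⟩
  · exact Ultrafilter.nonempty_of_mem ((sInter_mem F.finite_toSet).2 fun A hA => (hF hA).2)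
  · by_contra hAW
    classical
    have hAc : Aᶜ ∈ q := hle ⟨(DefAlg δ).compl_mem (hq hA), Ultrafilter.compl_mem_iff_notMem.2 hAW⟩
    obtain ⟨x, hx⟩ := hfip {A, Aᶜ} (by simp [Set.insert_subset_iff, hA, hAc])
    simp at hx

theorem IsCompleteType.exists_ultrafilter (hp : IsCompleteType δ p) :
    ∃ W : Ultrafilter G, p = trace (DefAlg δ) W := by
  have hne : (generate p).NeBot := generate_neBot_iff.2 fun t ht hfin => by
    simpa using hp.1.2 hfin.toFinset (by simpa using ht)
  have hsub : p ⊆ trace (DefAlg δ) (Ultrafilter.of (generate p)) := fun A hA =>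
    ⟨hp.1.1 hA, Ultrafilter.of_le (generate p) (mem_generate_of_mem hA)⟩
  exact ⟨_, hsub.antisymm (hp.2 (isCompleteType_trace _).1 hsub)⟩

variable [Group G] {H : Subgroup G}

theorem exists_isGenericType_mem (hδ : HasDoubleLimits δ) (hinv : IsInvariantRel G δ)
    {A : Set G} (hA : A ∈ DefAlg δ) (hgen : IsGeneric A) : ∃ p, IsGenericType δ p ∧ A ∈ p := by
  obtain ⟨V, hV⟩ := hδ.exists_finite_orbit hinv
  obtain ⟨g, hg⟩ := isGeneric_iff_forall_ultrafilter.1 hgen V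
  refine ⟨trace (DefAlg δ) (V.map (g⁻¹ • ·)), ⟨isCompleteType_trace _, fun C hC => ?_⟩, hA,
    smul_mem_ultrafilter_iff.1 hg⟩
  exact (isGeneric_iff_exists_smul_mem hδ hinv hV hC.1).2 ⟨g, smul_mem_ultrafilter_iff.2 hC.2⟩

theorem IsGenericType.eq_of_smul_subgroup_mem (hp : IsGenericType δ p) (hδ : HasDoubleLimits δ)
    (hinv : IsInvariantRel G δ) (hH : IsComponent δ H) {g : G} (hg : g • (H : Set G) ∈ p) :
    p = {A | A ∈ DefAlg δ ∧ IsGeneric (g • (H : Set G) ∩ A)} := by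
  obtain ⟨W, rfl⟩ := hp.1.exists_ultrafilter
  have hmem {A : Set G} (hA : A ∈ DefAlg δ) (hAW : A ∈ W) : IsGeneric (g • (H : Set G) ∩ A) :=
    hp.2 _ ⟨(DefAlg δ).infClosed hg.1 hA, inter_mem hg.2 hAW⟩
  ext A
  refine and_congr_right fun hA => ⟨hmem hA, fun hgen => ?_⟩
  by_contra hAW
  have hcompl := hmem ((DefAlg δ).compl_mem hA) (Ultrafilter.compl_mem_iff_notMem.2 hAW)
  exact (hH.xor_isGeneric hδ hinv hA g).elim (fun h => h.2 hcompl) fun h => h.2 hgen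

theorem IsComponent.existsUnique_isGenericType (hH : IsComponent δ H) (hδ : HasDoubleLimits δ)
    (hinv : IsInvariantRel G δ) (g : G) : ∃! p, IsGenericType δ p ∧ g • (H : Set G) ∈ p := by
  have := hH.1.1
  obtain ⟨p, hp, hgp⟩ := exists_isGenericType_mem hδ hinv (hinv.smul_mem g hH.1.2)
    (isGeneric_smul_iff.2 (isGeneric_subgroup H))
  refine ⟨p, ⟨hp, hgp⟩, fun q ⟨hq, hgq⟩ => ?_⟩
  rw [hq.eq_of_smul_subgroup_mem hδ hinv hH hgq, hp.eq_of_smul_subgroup_mem hδ hinv hH hgp]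

end Types

/-! ### Invariant measures -/

section Content

open MeasureTheory MulAction
open scoped NNReal

variable {G X Y : Type*} [Group G] [MulAction G X] {B : BooleanSubalgebra (Set X)} {A C : Set X}

theorem isSetRing (B : BooleanSubalgebra (Set X)) : IsSetRing (B : Set (Set X)) where
  empty_mem := B.bot_mem
  union_mem _ _ hA hC := B.supClosed hA hC
  sdiff_mem _ _ hA hC := B.sdiff_mem hA hC

variable {m : AddContent ℝ≥0 (B : Set (Set X))}

theorem addContent_inter_add_sdiff (hA : A ∈ B) (hC : C ∈ B) :
    m (A ∩ C) + m (A \ C) = m A := by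
  have hAC : A ∩ C ∈ B := B.infClosed hA hC
  rw [← addContent_union (isSetRing B) hAC (B.sdiff_mem hA hC)
    Set.disjoint_sdiff_inter.symm, Set.inter_union_sdiff]

theorem addContent_union_of_inter_null (hA : A ∈ B) (hC : C ∈ B) (hAC : m (A ∩ C) = 0) :
    m (A ∪ C) = m A + m C := by
  rw [← Set.union_sdiff_self, addContent_union (isSetRing B) hA (B.sdiff_mem hC hA)
    Set.disjoint_sdiff_right, ← addContent_inter_add_sdiff hC hA, Set.inter_comm, hAC, zero_add]

theorem addContent_eq_of_symmDiff_null (hA : A ∈ B) (hC : C ∈ B) (hAC : m (symmDiff A C) = 0) :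
    m A = m C := by
  have hsymm : symmDiff A C ∈ B := B.supClosed (B.sdiff_mem hA hC) (B.sdiff_mem hC hA)
  have hnull {D : Set X} (hD : D ∈ B) (hsub : D ⊆ symmDiff A C) : m D = 0 :=
    le_zero_iff.1 (hAC ▸ addContent_mono (isSetRing B).isSetSemiring hD hsymm hsub)
  rw [← addContent_inter_add_sdiff hA hC, ← addContent_inter_add_sdiff hC hA, Set.inter_comm,
    hnull (B.sdiff_mem hA hC) Set.subset_union_left,
    hnull (B.sdiff_mem hC hA) Set.subset_union_right]

theorem addContent_biUnion_null {ι : Type*} {s : ι → Set X} (hs : ∀ i, s i ∈ B) (t : Finset ι)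
    (hnull : ∀ i ∈ t, m (s i) = 0) : m (⋃ i ∈ t, s i) = 0 :=
  le_zero_iff.1 ((addContent_biUnion_le (isSetRing B) fun i _ => hs i).trans_eq
    (Finset.sum_eq_zero hnull))

theorem addContent_biUnion_range_of_inter_null {s : ℕ → Set X} (hs : ∀ i, s i ∈ B)
    (hnull : Pairwise fun i j => m (s i ∩ s j) = 0) (n : ℕ) :
    m (⋃ i ∈ Finset.range n, s i) = ∑ i ∈ Finset.range n, m (s i) := by
  induction n with
  | zero => simp
  | succ n ih =>
    have hunion := (isSetRing B).biUnion_mem (Finset.range n) fun i _ => hs i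
    rw [Finset.sum_range_succ, ← ih, Finset.range_add_one, Finset.set_biUnion_insert,
      addContent_union_of_inter_null (hs n) hunion, add_comm]
    rw [Set.inter_iUnion₂]
    exact addContent_biUnion_null (fun i => B.infClosed (hs n) (hs i)) _ fun i hi =>
      hnull (Finset.mem_range.1 hi).ne'

/-- The filter of sets whose complement is contained in a null set of a content. -/
def conullFilter (m : AddContent ℝ≥0 (B : Set (Set X))) : Filter X where
  sets := {S | ∃ A ∈ B, m A = 0 ∧ Aᶜ ⊆ S}
  univ_sets := ⟨∅, B.bot_mem, addContent_empty, Set.subset_univ _⟩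
  sets_of_superset := fun ⟨A, hA, hA0, hAS⟩ hST => ⟨A, hA, hA0, hAS.trans hST⟩
  inter_sets := fun ⟨A, hA, hA0, hAS⟩ ⟨C, hC, hC0, hCT⟩ =>
    ⟨A ∪ C, B.supClosed hA hC,
      le_zero_iff.1 ((addContent_union_le (isSetRing B) hA hC).trans_eq
        (by rw [hA0, hC0, add_zero])),
      by rw [Set.compl_union]; exact Set.inter_subset_inter hAS hCT⟩

theorem conullFilter_inf_principal_neBot_iff (hA : A ∈ B) :
    (conullFilter m ⊓ 𝓟 A).NeBot ↔ m A ≠ 0 := by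
  rw [neBot_iff, ne_eq, inf_principal_eq_bot, not_iff_not]
  constructor
  · rintro ⟨C, hC, hC0, hCA⟩
    exact le_zero_iff.1 (hC0 ▸ addContent_mono (isSetRing B).isSetSemiring hA hC
      (Set.compl_subset_compl.1 hCA))
  · exact fun hA0 => ⟨A, hA, hA0, subset_rfl⟩

theorem smul_conullFilter_le (hB : ∀ g : G, ∀ A ∈ B, g • A ∈ B)
    (hm : ∀ g : G, ∀ A ∈ B, m (g • A) = m A) (g : G) : g • conullFilter m ≤ conullFilter m := by
  rintro S ⟨A, hA, hA0, hAS⟩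
  rw [mem_smul_filter_iff]
  refine ⟨g⁻¹ • A, hB _ A hA, (hm _ A hA).trans hA0, ?_⟩
  rw [← Set.smul_set_compl]
  exact Set.smul_set_mono hAS

/-- Otherwise there are infinitely many translates of `A` with null pairwise intersections. -/
theorem exists_finite_forall_addContent_smul_inter_ne_zero (hB : ∀ g : G, ∀ A ∈ B, g • A ∈ B)
    (hm : ∀ g : G, ∀ A ∈ B, m (g • A) = m A) (hA : A ∈ B) (hA0 : m A ≠ 0) :
    ∃ t : Finset G, ∀ g : G, ∃ k ∈ t, m (g • A ∩ k • A) ≠ 0 := by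
  by_contra! hcon
  have : Std.Symm fun g k : G => m (g • A ∩ k • A) = 0 :=
    ⟨fun g k h => by rwa [Set.inter_comm]⟩
  obtain ⟨f, -, hf⟩ := exists_seq_of_forall_finset_exists' (fun _ => True)
    (fun g k : G => m (g • A ∩ k • A) = 0) fun t _ =>
      (hcon t).imp fun g hg => ⟨trivial, fun k hk => by rw [Set.inter_comm]; exact hg k hk⟩
  have hfA (i : ℕ) : f i • A ∈ B := hB _ A hA
  obtain ⟨n, hn⟩ := Archimedean.arch (m Set.univ + 1) (pos_iff_ne_zero.2 hA0)
  have hle : n • m A ≤ m Set.univ := calc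
    n • m A = m (⋃ i ∈ Finset.range n, f i • A) := by
      rw [addContent_biUnion_range_of_inter_null hfA hf]
      simp [hm _ A hA]
    _ ≤ m Set.univ := addContent_mono (isSetRing B).isSetSemiring
      ((isSetRing B).biUnion_mem _ fun i _ => hfA i) B.top_mem (Set.subset_univ _)
  exact (lt_add_one _).not_ge (hn.trans hle)

variable {R : G → Y → Prop} {μ : AddContent ℝ≥0 (instanceAlgebra R : Set (Set G))} {A : Set G}

theorem isGeneric_of_addContent_ne_zero (hR : HasDoubleLimits R) (hinv : IsInvariantRel G R)
    (hμ : ∀ g : G, ∀ A ∈ instanceAlgebra R, μ (g • A) = μ A) (hA : A ∈ instanceAlgebra R)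
    (hA0 : μ A ≠ 0) : IsGeneric A := by
  have hB : ∀ g : G, ∀ A ∈ instanceAlgebra R, g • A ∈ instanceAlgebra R :=
    fun g A hA => hinv.smul_mem g hA
  have hF := smul_conullFilter_le hB hμ
  have := (conullFilter_inf_principal_neBot_iff hA).2 hA0
  obtain ⟨C, hC, hFC, hdec⟩ := hR.exists_decided (conullFilter μ ⊓ 𝓟 A)
  rw [inf_assoc, inf_principal] at hFC hdec
  have hAC : A ∩ C ∈ instanceAlgebra R := (instanceAlgebra R).infClosed hA hC
  obtain ⟨t, ht⟩ := exists_finite_forall_addContent_smul_inter_ne_zero hB hμ hAC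
    ((conullFilter_inf_principal_neBot_iff hAC).1 hFC)
  let V := Ultrafilter.of (conullFilter μ ⊓ 𝓟 (A ∩ C))
  have hV : ↑V ≤ conullFilter μ ⊓ 𝓟 (A ∩ C) := Ultrafilter.of_le _
  refine isGeneric_of_mem (V := V) hR hinv ?_ hA
    (mem_of_superset (le_principal_iff.1 (hV.trans inf_le_right)) Set.inter_subset_left)
  rw [Decides.trace_eq hdec hV]
  refine finite_orbit_trace hB hF hdec t.finite_toSet fun g => (ht g).imp fun k hk => ⟨hk.1, ?_⟩
  exact (conullFilter_inf_principal_neBot_iff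
    ((instanceAlgebra R).infClosed (hB g _ hAC) (hB k _ hAC))).2 hk.2

theorem IsGeneric.addContent_ne_zero (hA : IsGeneric A) (hinv : IsInvariantRel G R)
    (hμ : ∀ g : G, ∀ A ∈ instanceAlgebra R, μ (g • A) = μ A) (hμ0 : μ Set.univ ≠ 0)
    (hAR : A ∈ instanceAlgebra R) : μ A ≠ 0 := by
  obtain ⟨t, ht⟩ := hA
  intro hA0
  exact hμ0 (ht ▸ addContent_biUnion_null (fun g => hinv.smul_mem g hAR) t
    fun g _ => (hμ g A hAR).trans hA0)

end Content

section CosetCount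

open MeasureTheory
open scoped NNReal

variable {G Y : Type*} [Group G] {R : G → Y → Prop} {H : Subgroup G} {A C : Set G}

theorem classes_leftRel (H : Subgroup G) :
    (QuotientGroup.leftRel H).classes = Set.range fun g : G => g • (H : Set G) := by
  have hclass (g : G) : {x | QuotientGroup.leftRel H x g} = g • (H : Set G) := by
    rw [← QuotientGroup.eq_class_eq_leftCoset]
    exact Set.ext fun x => (Quotient.eq'' (s₁ := QuotientGroup.leftRel H)).symm
  ext C
  exact exists_congr fun g => by rw [hclass, eq_comm]

theorem finite_classes_leftRel (H : Subgroup G) [H.FiniteIndex] :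
    (QuotientGroup.leftRel H).classes.Finite :=
  have : Finite (Quotient (QuotientGroup.leftRel H)) := inferInstanceAs (Finite (G ⧸ H))
  Finite.of_equiv _ (Setoid.quotientEquivClasses _)

theorem genericCosets_subset_classes : genericCosets H A ⊆ (QuotientGroup.leftRel H).classes := by
  rw [classes_leftRel]
  rintro _ ⟨⟨g, rfl⟩, -⟩
  exact ⟨g, rfl⟩

theorem finite_genericCosets [H.FiniteIndex] : (genericCosets H A).Finite :=
  (finite_classes_leftRel H).subset genericCosets_subset_classes

theorem pairwiseDisjoint_genericCosets : (genericCosets H A).PairwiseDisjoint id :=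
  (Setoid.isPartition_classes _).pairwiseDisjoint.subset genericCosets_subset_classes

theorem genericCosets_smul (g : G) : genericCosets H (g • A) = g • genericCosets H A := by
  ext C
  rw [Set.mem_smul_set_iff_inv_smul_mem]
  refine and_congr ⟨?_, ?_⟩ ?_
  · rintro ⟨k, rfl⟩
    exact ⟨g⁻¹ * k, smul_smul ..⟩
  · rintro ⟨k, hk⟩
    exact ⟨g * k, by rw [mul_smul, ← hk, smul_inv_smul]⟩
  · rw [← isGeneric_smul_iff (g := g⁻¹), Set.smul_set_inter, inv_smul_smul]

theorem genericCosets_union (hR : HasDoubleLimits R) (hinv : IsInvariantRel G R)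
    (hH : (H : Set G) ∈ instanceAlgebra R) (hA : A ∈ instanceAlgebra R)
    (hC : C ∈ instanceAlgebra R) :
    genericCosets H (A ∪ C) = genericCosets H A ∪ genericCosets H C := by
  ext D
  rw [Set.mem_union, genericCosets, genericCosets, genericCosets, Set.mem_ofPred_eq,
    Set.mem_ofPred_eq, Set.mem_ofPred_eq, ← and_or_left]
  refine and_congr_right ?_
  rintro ⟨g, rfl⟩
  have hgH := hinv.smul_mem g hH
  rw [Set.inter_union_distrib_left]
  exact isGeneric_union_iff hR hinv ((instanceAlgebra R).infClosed hgH hA)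
    ((instanceAlgebra R).infClosed hgH hC)

theorem IsComponent.disjoint_genericCosets (hH : IsComponent R H) (hR : HasDoubleLimits R)
    (hinv : IsInvariantRel G R) (hA : A ∈ instanceAlgebra R) (hAC : Disjoint A C) :
    Disjoint (genericCosets H A) (genericCosets H C) := by
  rw [Set.disjoint_left]
  rintro _ ⟨⟨g, rfl⟩, hgA⟩ ⟨-, hgC⟩
  have hdiff : IsGeneric (g • (H : Set G) \ A) :=
    hgC.mono fun x hx => ⟨hx.1, Set.disjoint_right.1 hAC hx.2⟩
  exact (hH.xor_isGeneric hR hinv hA g).elim (fun h => h.2 hdiff) fun h => h.2 hgA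

theorem IsComponent.ncard_genericCosets_union (hH : IsComponent R H) (hR : HasDoubleLimits R)
    (hinv : IsInvariantRel G R) (hA : A ∈ instanceAlgebra R) (hC : C ∈ instanceAlgebra R)
    (hAC : Disjoint A C) : (genericCosets H (A ∪ C)).ncard =
      (genericCosets H A).ncard + (genericCosets H C).ncard := by
  have := hH.1.1
  rw [genericCosets_union hR hinv hH.1.2 hA hC,
    Set.ncard_union_eq (hH.disjoint_genericCosets hR hinv hA hAC) finite_genericCosets
      finite_genericCosets]

theorem ncard_genericCosets_univ_ne_zero [H.FiniteIndex] :
    (genericCosets H Set.univ).ncard ≠ 0 := by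
  refine Set.ncard_ne_zero_of_mem (a := (H : Set G)) ⟨⟨1, (one_smul G _).symm⟩, ?_⟩
    finite_genericCosets
  rw [Set.inter_univ]
  exact isGeneric_subgroup H

variable {μ : AddContent ℝ≥0 (instanceAlgebra R : Set (Set G))}

theorem sUnion_genericCosets_mem [H.FiniteIndex] (hinv : IsInvariantRel G R)
    (hH : (H : Set G) ∈ instanceAlgebra R) : ⋃₀ genericCosets H A ∈ instanceAlgebra R := by
  refine (instanceAlgebra R).supClosed.sSup_mem finite_genericCosets
    (instanceAlgebra R).bot_mem ?_
  rintro _ ⟨⟨g, rfl⟩, -⟩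
  exact hinv.smul_mem g hH

theorem addContent_sUnion_genericCosets [H.FiniteIndex] (hinv : IsInvariantRel G R)
    (hμ : ∀ g : G, ∀ A ∈ instanceAlgebra R, μ (g • A) = μ A)
    (hH : (H : Set G) ∈ instanceAlgebra R) :
    μ (⋃₀ genericCosets H A) = (genericCosets H A).ncard * μ H := by
  obtain ⟨I, hI⟩ := (finite_genericCosets (H := H) (A := A)).exists_finset_coe
  have hcoset : ∀ C ∈ I, ∃ g : G, C = g • (H : Set G) := fun C hC =>
    (hI ▸ Finset.mem_coe.2 hC : C ∈ genericCosets H A).1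
  rw [← hI, addContent_sUnion, Set.ncard_coe_finset, ← nsmul_eq_mul]
  · refine Finset.sum_eq_card_nsmul fun C hC => ?_
    obtain ⟨g, rfl⟩ := hcoset C hC
    exact hμ g H hH
  · intro C hC
    obtain ⟨g, rfl⟩ := hcoset C hC
    exact hinv.smul_mem g hH
  · exact hI ▸ pairwiseDisjoint_genericCosets
  · exact hI ▸ sUnion_genericCosets_mem hinv hH

theorem IsComponent.addContent_eq (hH : IsComponent R H) (hR : HasDoubleLimits R)
    (hinv : IsInvariantRel G R) (hμ : ∀ g : G, ∀ A ∈ instanceAlgebra R, μ (g • A) = μ A)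
    (hA : A ∈ instanceAlgebra R) : μ A = (genericCosets H A).ncard * μ H := by
  have := hH.1.1
  have hY : ⋃₀ genericCosets H A ∈ instanceAlgebra R := sUnion_genericCosets_mem hinv hH.1.2
  have hsymm : symmDiff A (⋃₀ genericCosets H A) ∈ instanceAlgebra R :=
    (instanceAlgebra R).supClosed ((instanceAlgebra R).sdiff_mem hA hY)
      ((instanceAlgebra R).sdiff_mem hY hA)
  have hnull : μ (symmDiff A (⋃₀ genericCosets H A)) = 0 := by
    by_contra h0
    exact hH.not_isGeneric_symmDiff hR hinv hA (isGeneric_of_addContent_ne_zero hR hinv hμ hsymm h0)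
  rw [addContent_eq_of_symmDiff_null hA hY hnull, addContent_sUnion_genericCosets hinv hμ hH.1.2]

theorem IsComponent.addContent_eq_div (hH : IsComponent R H) (hR : HasDoubleLimits R)
    (hinv : IsInvariantRel G R) (hμ : ∀ g : G, ∀ A ∈ instanceAlgebra R, μ (g • A) = μ A)
    (hμ1 : μ Set.univ = 1) (hA : A ∈ instanceAlgebra R) :
    μ A = (genericCosets H A).ncard / (genericCosets H Set.univ).ncard := by
  have := hH.1.1
  have huniv : Set.univ ∈ instanceAlgebra R := (instanceAlgebra R).top_mem
  rw [hH.addContent_eq hR hinv hμ huniv] at hμ1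
  rw [hH.addContent_eq hR hinv hμ hA, eq_div_iff
    (Nat.cast_ne_zero.2 ncard_genericCosets_univ_ne_zero), mul_assoc, mul_comm (μ H), hμ1, mul_one]

end CosetCount

section Keisler

open MeasureTheory
open scoped NNReal

variable {G : Type*} {n : ℕ} {δ : G → (Fin n → G) → Prop} {μ : DefAlg δ → ℝ}

theorem IsKeislerMeasure.exists_addContent (hμ : IsKeislerMeasure δ μ) :
    ∃ ν : AddContent ℝ≥0 (DefAlg δ : Set (Set G)), ∀ A : DefAlg δ, (ν A : ℝ) = μ A := by
  have hbot : μ ⊥ = 0 := by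
    have h := hμ.2.2 ⊥ ⊥ (Set.disjoint_empty _)
    rwa [sup_bot_eq, left_eq_add] at h
  let f : Set G → ℝ≥0 := Function.extend Subtype.val (fun A : DefAlg δ => (μ A).toNNReal) 0
  have hf (A : DefAlg δ) : f A = (μ A).toNNReal := Subtype.val_injective.extend_apply ..
  refine ⟨(isSetRing (DefAlg δ)).addContent_of_union f ?_ ?_, fun A => ?_⟩
  · exact (hf ⊥).trans (by rw [hbot, Real.toNNReal_zero])
  · intro A C hA hC hAC
    have hadd := hμ.2.2 ⟨A, hA⟩ ⟨C, hC⟩ hAC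
    exact (hf (⟨A, hA⟩ ⊔ ⟨C, hC⟩)).trans (by
      rw [hadd, Real.toNNReal_add (hμ.1 _) (hμ.1 _), ← hf, ← hf])
  · exact (congrArg NNReal.toReal (hf A)).trans (Real.coe_toNNReal _ (hμ.1 A))

variable [Group G] {H : Subgroup G}

theorem IsLeftInvariantMeasure.addContent_smul (hμ : IsLeftInvariantMeasure δ μ)
    (hinv : IsInvariantRel G δ) {ν : AddContent ℝ≥0 (DefAlg δ : Set (Set G))}
    (hν : ∀ A : DefAlg δ, (ν A : ℝ) = μ A) (g : G) (A : Set G) (hA : A ∈ DefAlg δ) :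
    ν (g • A) = ν A :=
  NNReal.eq <| (hν ⟨g • A, hinv.smul_mem g hA⟩).trans <|
    (hμ g ⟨A, hA⟩ _ rfl).trans (hν ⟨A, hA⟩).symm

theorem IsKeislerMeasure.pos_iff (hμ : IsKeislerMeasure δ μ) (hμ' : IsLeftInvariantMeasure δ μ)
    (hδ : HasDoubleLimits δ) (hinv : IsInvariantRel G δ) (A : DefAlg δ) :
    0 < μ A ↔ IsGeneric (A : Set G) := by
  obtain ⟨ν, hν⟩ := hμ.exists_addContent
  have hνinv := hμ'.addContent_smul hinv hν
  have hν1 : ν Set.univ ≠ 0 := by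
    rw [← NNReal.coe_ne_zero]
    exact ((hν ⊤).trans hμ.2.1).trans_ne one_ne_zero
  rw [← hν, NNReal.coe_pos, pos_iff_ne_zero]
  exact ⟨isGeneric_of_addContent_ne_zero hδ hinv hνinv A.2,
    fun hA => hA.addContent_ne_zero hinv hνinv hν1 A.2⟩

theorem IsComponent.keislerMeasure_eq (hH : IsComponent δ H) (hδ : HasDoubleLimits δ)
    (hinv : IsInvariantRel G δ) (hμ : IsKeislerMeasure δ μ) (hμ' : IsLeftInvariantMeasure δ μ)
    (A : DefAlg δ) :
    μ A = (genericCosets H (A : Set G)).ncard / (genericCosets H Set.univ).ncard := by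
  obtain ⟨ν, hν⟩ := hμ.exists_addContent
  have hν1 : ν Set.univ = 1 := NNReal.eq ((hν ⊤).trans hμ.2.1)
  have hdiv := congrArg NNReal.toReal
    (hH.addContent_eq_div hδ hinv (hμ'.addContent_smul hinv hν) hν1 A.2)
  push_cast at hdiv
  exact (hν A).symm.trans hdiv

theorem IsComponent.isKeislerMeasure (hH : IsComponent δ H) (hδ : HasDoubleLimits δ)
    (hinv : IsInvariantRel G δ) : IsKeislerMeasure δ fun A =>
      (genericCosets H (A : Set G)).ncard / (genericCosets H Set.univ).ncard := by
  have := hH.1.1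
  refine ⟨fun A => by positivity, div_self ?_, fun A C hAC => ?_⟩
  · exact Nat.cast_ne_zero.2 ncard_genericCosets_univ_ne_zero
  · rw [← add_div, ← Nat.cast_add, ← hH.ncard_genericCosets_union hδ hinv A.2 C.2 hAC]
    rfl

theorem IsComponent.existsUnique_keislerMeasure (hH : IsComponent δ H) (hδ : HasDoubleLimits δ)
    (hinv : IsInvariantRel G δ) :
    ∃! μ : DefAlg δ → ℝ, IsKeislerMeasure δ μ ∧ IsLeftInvariantMeasure δ μ := by
  refine ⟨_, ⟨hH.isKeislerMeasure hδ hinv, fun g A C hC => ?_⟩,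
    fun μ hμ => funext (hH.keislerMeasure_eq hδ hinv hμ.1 hμ.2)⟩
  simp only [hC, genericCosets_smul, Set.ncard_smul_set]

end Keisler

/-! ### Definability of the component -/

section Cover

variable {G Y : Type*} [Group G] {R : G → Y → Prop} {H : Subgroup G}

theorem exists_cover_of_finiteIndex (K : Subgroup G) [K.FiniteIndex] :
    ∃ g : Fin K.index → G, ∀ x, ∃ i, (g i)⁻¹ * x ∈ K := by
  let e : G ⧸ K ≃ Fin K.index := Finite.equivFin (G ⧸ K)
  refine ⟨fun i => (e.symm i).out, fun x => ⟨e x, ?_⟩⟩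
  rw [← QuotientGroup.eq, QuotientGroup.out_eq', e.symm_apply_apply]

theorem finiteIndex_of_cover {ι : Type*} [Finite ι] {K : Subgroup G} {g : ι → G}
    (hg : ∀ x, ∃ i, (g i)⁻¹ * x ∈ K) : K.FiniteIndex := by
  have : Finite (G ⧸ K) := .of_surjective (fun i => (g i : G ⧸ K)) fun q => by
    obtain ⟨x, rfl⟩ := QuotientGroup.mk_surjective q
    obtain ⟨i, hi⟩ := hg x
    exact ⟨i, QuotientGroup.eq.2 hi⟩
  exact Subgroup.finiteIndex_of_finite_quotient

/-- The index bound `H.index` makes the quantification over finite index subgroups first-order. -/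
theorem IsComponent.mem_iff_forall_cover (hH : IsComponent R H) (hinv : IsInvariantRel G R)
    {P : Type*} {Ψ : P → Set G} (hΨ : ∀ c, Ψ c ∈ instanceAlgebra R) (hΨH : ∃ c, Ψ c = H) {y : G} :
    y ∈ H ↔ ∀ c, (∃ g : Fin H.index → G, ∀ x, ∃ i, (g i)⁻¹ * x ∈ rightStabilizer (Ψ c)) →
      y ∈ rightStabilizer (Ψ c) := by
  constructor
  · rintro hy c ⟨g, hg⟩
    have := finiteIndex_of_cover hg
    exact hH.le_rightStabilizer hinv (hΨ c) hy
  · intro h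
    have := hH.1.1
    obtain ⟨c, hc⟩ := hΨH
    simpa [hc] using h c (by simpa [hc] using exists_cover_of_finiteIndex H)

end Cover

section Definability

open FirstOrder FirstOrder.Language

universe u

variable {L : Language} {G α : Type*} {ι : Type u} [L.Structure G] {Ψ : (ι → G) → Set G}

variable (L) in
/-- A family of subsets of `G` indexed by tuples of parameters that is uniformly definable: the
defining formula has the parameters and one further variable as its free variables. -/
def IsDefinableFamily (Ψ : (ι → G) → Set G) : Prop :=
  (∅ : Set G).Definable L {v : ι ⊕ Unit → G | v (Sum.inr ()) ∈ Ψ (v ∘ Sum.inl)}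

theorem IsDefinableFamily.definable_preimage [Finite ι] (hΨ : IsDefinableFamily L Ψ)
    {f : (α → G) → G} (hf : (∅ : Set G).DefinableFun L f) (s : ι → α) :
    (∅ : Set G).Definable L {v | f v ∈ Ψ (v ∘ s)} := by
  have hF : (∅ : Set G).DefinableMap L fun v => Sum.elim (v ∘ s) fun _ : Unit => f v :=
    Sum.forall.2 ⟨fun i => .proj L, fun _ => hf⟩
  exact hΨ.preimage_map hF

theorem definable_imp {p q : (α → G) → Prop} (hp : (∅ : Set G).Definable L {v | p v})
    (hq : (∅ : Set G).Definable L {v | q v}) : (∅ : Set G).Definable L {v | p v → q v} := by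
  convert hp.compl.union hq using 1
  exact Set.ext fun v => imp_iff_not_or

theorem definable_iff {p q : (α → G) → Prop} (hp : (∅ : Set G).Definable L {v | p v})
    (hq : (∅ : Set G).Definable L {v | q v}) : (∅ : Set G).Definable L {v | p v ↔ q v} := by
  simp only [iff_def]
  exact (definable_imp hp hq).inter (definable_imp hq hp)

theorem definable_forall {p : (α → G) → G → Prop}
    (hp : (∅ : Set G).Definable L {v : α ⊕ Unit → G | p (v ∘ Sum.inl) (v (Sum.inr ()))}) :
    (∅ : Set G).Definable L {v | ∀ x, p v x} := by
  convert hp.forall_of_finite using 1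
  exact Set.ext fun v => ⟨fun h u => h (u ()), fun h x => h fun _ => x⟩

theorem definableFun_comp₂ {m : G → G → G}
    (hm : (∅ : Set G).DefinableFun L fun v : Fin 2 → G => m (v 0) (v 1)) (a b : α) :
    (∅ : Set G).DefinableFun L fun v : α → G => m (v a) (v b) :=
  hm.comp (g := fun v => ![v a, v b]) (Fin.forall_fin_two.2 ⟨.proj L, .proj L⟩)

theorem exists_isDefinableFamily [Finite ι] {R : G → (ι → G) → Prop}
    (hR : IsDefinableFamily L fun b => {x | R x b}) {A : Set G} (hA : A ∈ instanceAlgebra R) :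
    ∃ (κ : Type u) (_ : Finite κ) (Ψ : (κ → G) → Set G), IsDefinableFamily L Ψ ∧
      (∀ c, Ψ c ∈ instanceAlgebra R) ∧ ∃ c, Ψ c = A := by
  induction hA using BooleanSubalgebra.closure_bot_sup_induction with
  | mem A hA =>
    obtain ⟨b, rfl⟩ := hA
    exact ⟨ι, inferInstance, fun b => {x | R x b}, hR, mem_instanceAlgebra R, b, rfl⟩
  | bot =>
    exact ⟨PEmpty, inferInstance, fun _ => ∅, Set.definable_empty,
      fun _ => (instanceAlgebra R).bot_mem, PEmpty.elim, rfl⟩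
  | sup A hA C hC ihA ihC =>
    obtain ⟨κ, _, Ψ, hΨ, hΨR, c, rfl⟩ := ihA
    obtain ⟨κ', _, Θ, hΘ, hΘR, d, rfl⟩ := ihC
    refine ⟨κ ⊕ κ', inferInstance, fun e => Ψ (e ∘ Sum.inl) ∪ Θ (e ∘ Sum.inr), ?_,
      fun e => (instanceAlgebra R).supClosed (hΨR _) (hΘR _), Sum.elim c d, rfl⟩
    exact (hΨ.definable_preimage (.proj L) (Sum.inl ∘ Sum.inl)).union
      (hΘ.definable_preimage (.proj L) (Sum.inl ∘ Sum.inr))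
  | compl A hA ih =>
    obtain ⟨κ, hκ, Ψ, hΨ, hΨR, c, rfl⟩ := ih
    exact ⟨κ, hκ, fun e => (Ψ e)ᶜ, hΨ.compl, fun e => (instanceAlgebra R).compl_mem (hΨR e), c, rfl⟩

variable [Group G] {R : G → (ι → G) → Prop} {H : Subgroup G}

theorem IsDefinableFamily.rightStabilizer (hΨ : IsDefinableFamily L Ψ) [Finite ι]
    (hmul : (∅ : Set G).DefinableFun L fun v : Fin 2 → G => v 0 * v 1) :
    IsDefinableFamily L fun c => (rightStabilizer (Ψ c) : Set G) := by
  simp only [IsDefinableFamily, SetLike.mem_coe, mem_rightStabilizer]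
  refine definable_forall (definable_iff ?_ ?_)
  · exact hΨ.definable_preimage
      (definableFun_comp₂ (m := (· * ·)) hmul (Sum.inr ()) (Sum.inl (Sum.inr ())))
      (Sum.inl ∘ Sum.inl)
  · exact hΨ.definable_preimage (.proj L) (Sum.inl ∘ Sum.inl)

theorem IsDefinableFamily.definable_exists_cover [Finite ι] (hΨ : IsDefinableFamily L Ψ)
    (hdiv : (∅ : Set G).DefinableFun L fun v : Fin 2 → G => (v 0)⁻¹ * v 1) (N : ℕ) :
    (∅ : Set G).Definable L {c | ∃ g : Fin N → G, ∀ x, ∃ i, (g i)⁻¹ * x ∈ Ψ c} := by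
  have hmem (i : Fin N) := hΨ.definable_preimage
    (definableFun_comp₂ (m := fun x y => x⁻¹ * y) hdiv (Sum.inl (Sum.inr i)) (Sum.inr ()))
    (Sum.inl ∘ Sum.inl)
  refine Set.Definable.exists_of_finite (β := Fin N)
    (S := {w | ∀ x, ∃ i, (w (Sum.inr i))⁻¹ * x ∈ Ψ (w ∘ Sum.inl)}) (definable_forall ?_)
  convert Set.definable_iUnion_of_finite hmem using 1
  exact (Set.iUnion_ofPred _).symm

theorem IsComponent.definable [Finite ι] (hH : IsComponent R H) (hinv : IsInvariantRel G R)
    (hmul : (∅ : Set G).DefinableFun L fun v : Fin 2 → G => v 0 * v 1)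
    (hdiv : (∅ : Set G).DefinableFun L fun v : Fin 2 → G => (v 0)⁻¹ * v 1)
    (hR : IsDefinableFamily L fun b => {x | R x b}) :
    (∅ : Set G).Definable L {v : Fin 2 → G | (v 0)⁻¹ * v 1 ∈ H} := by
  obtain ⟨κ, _, Ψ, hΨ, hΨR, hΨH⟩ := exists_isDefinableFamily hR hH.1.2
  have hstab := hΨ.rightStabilizer hmul
  simp only [hH.mem_iff_forall_cover hinv hΨR hΨH]
  refine Set.Definable.forall_of_finite (S := {w : Fin 2 ⊕ κ → G |
    (∃ g : Fin H.index → G, ∀ x, ∃ i, (g i)⁻¹ * x ∈ LocalStable.rightStabilizer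
      (Ψ (w ∘ Sum.inr))) → (w (Sum.inl 0))⁻¹ * w (Sum.inl 1) ∈
      LocalStable.rightStabilizer (Ψ (w ∘ Sum.inr))}) (definable_imp ?_ ?_)
  · exact (hstab.definable_exists_cover hdiv _).preimage_comp Sum.inr
  · exact hstab.definable_preimage
      (definableFun_comp₂ (m := fun x y => x⁻¹ * y) hdiv _ _) _

theorem IsComponent.isEmptyDefinable {n : ℕ} {δ : G → (Fin n → G) → Prop} (hH : IsComponent δ H)
    (hinv : IsInvariantRel G δ) : IsEmptyDefinable δ {z | QuotientGroup.leftRel H z.1 z.2} := by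
  let _ := deltaStructure δ
  simp only [QuotientGroup.leftRel_apply]
  refine hH.definable (L := deltaLanguage n) hinv ?_ ?_ ?_
  · exact Term.definableFun_realize (L := deltaLanguage n)
      (Term.func (l := 2) GroupFunc.mul ![.var 0, .var 1])
  · exact Term.definableFun_realize (L := deltaLanguage n)
      (Term.func (l := 2) GroupFunc.mul ![.func (l := 1) GroupFunc.inv ![.var 0], .var 1])
  · let d : (deltaLanguage n).Relations (n + 1) := DeltaRel.delta
    let φ : (deltaLanguage n).Formula (Fin n ⊕ Unit) :=
      d.formula (Fin.cons (.var (Sum.inr ())) fun i => .var (Sum.inl i))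
    refine Set.empty_definable_iff.2 ⟨φ, Set.ext fun v => Iff.symm ?_⟩
    exact Formula.realize_rel (R := d) (v := v)

end Definability

section EDelta

variable {G : Type*} [Group G] {n : ℕ} {δ : G → (Fin n → G) → Prop} {H K : Subgroup G}
  {p : Set (Set G)}

theorem identityClass_leftRel (H : Subgroup G) :
    identityClass (QuotientGroup.leftRel H) = H := by
  ext x
  change QuotientGroup.leftRel H x 1 ↔ x ∈ H
  rw [QuotientGroup.leftRel_apply, mul_one, inv_mem_iff]

theorem exists_eq_leftRel {E : Setoid G} (hE : ∀ a b g : G, E a b ↔ E (g * a) (g * b)) :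
    ∃ K : Subgroup G, E = QuotientGroup.leftRel K := by
  have hE1 {a b : G} : E a b ↔ E 1 (a⁻¹ * b) := by rw [hE a b a⁻¹, inv_mul_cancel]
  let K : Subgroup G :=
    { carrier := {x | E 1 x}
      one_mem' := E.refl 1
      mul_mem' := fun {x y} hx hy => E.trans hx (hE1.2 (by rwa [inv_mul_cancel_left]))
      inv_mem' := fun {x} hx => by simpa using hE1.1 (E.symm hx) }
  refine ⟨K, Setoid.ext fun a b => ?_⟩
  rw [QuotientGroup.leftRel_apply]
  exact hE1

theorem finiteIndex_of_finite_classes (hK : (QuotientGroup.leftRel K).classes.Finite) :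
    K.FiniteIndex := by
  have := hK.to_subtype
  have : Finite (G ⧸ K) :=
    .of_equiv _ (Setoid.quotientEquivClasses (QuotientGroup.leftRel K)).symm
  exact Subgroup.finiteIndex_of_finite_quotient

theorem IsCompleteType.exists_smul_subgroup_mem [H.FiniteIndex] (hp : IsCompleteType δ p)
    (hinv : IsInvariantRel G δ) (hH : (H : Set G) ∈ DefAlg δ) : ∃ g : G, g • (H : Set G) ∈ p := by
  obtain ⟨W, rfl⟩ := hp.exists_ultrafilter
  obtain ⟨g, hg⟩ := isGeneric_iff_forall_ultrafilter.1 (isGeneric_subgroup H) W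
  exact ⟨g, hinv.smul_mem g hH, hg⟩

theorem IsCompleteType.mem_of_subset {X : Type*} {δ : X → (Fin n → X) → Prop} {p : Set (Set X)}
    {A C : Set X} (hp : IsCompleteType δ p) (hA : A ∈ p) (hC : C ∈ DefAlg δ)
    (hAC : A ⊆ C) : C ∈ p := by
  obtain ⟨W, rfl⟩ := hp.exists_ultrafilter
  exact ⟨hC, mem_of_superset hA.2 hAC⟩

theorem IsComponent.isEDelta (hH : IsComponent δ H) (hδ : HasDoubleLimits δ)
    (hinv : IsInvariantRel G δ) : IsEDelta δ (QuotientGroup.leftRel H) := by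
  have := hH.1.1
  refine ⟨⟨hH.isEmptyDefinable hinv, finite_classes_leftRel H, ?_⟩, fun a b g => ?_,
    fun p q hp hq => ⟨?_, ?_⟩⟩
  · rw [classes_leftRel]
    rintro _ ⟨g, rfl⟩
    exact hinv.smul_mem g hH.1.2
  · simp [QuotientGroup.leftRel_apply, mul_assoc]
  · rintro rfl
    obtain ⟨g, hg⟩ := hp.1.exists_smul_subgroup_mem hinv hH.1.2
    exact ⟨g • (H : Set G), classes_leftRel H ▸ ⟨g, rfl⟩, hg, hg⟩
  · rw [classes_leftRel]
    rintro ⟨_, ⟨g, rfl⟩, hgp, hgq⟩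
    rw [hp.eq_of_smul_subgroup_mem hδ hinv hH hgp, hq.eq_of_smul_subgroup_mem hδ hinv hH hgq]

/-- The generic types of two cosets of `H` inside `K` both contain `K`, hence are equal. -/
theorem IsComponent.le_of_isEDelta (hH : IsComponent δ H) (hδ : HasDoubleLimits δ)
    (hinv : IsInvariantRel G δ) (hHK : H ≤ K) (hK : IsEDelta δ (QuotientGroup.leftRel K)) :
    K ≤ H := by
  intro x hx
  have hKclass : (K : Set G) ∈ (QuotientGroup.leftRel K).classes :=
    classes_leftRel K ▸ ⟨1, one_smul _ _⟩
  obtain ⟨p, ⟨hp, hHp⟩, -⟩ := hH.existsUnique_isGenericType hδ hinv 1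
  obtain ⟨q, ⟨hq, hxq⟩, -⟩ := hH.existsUnique_isGenericType hδ hinv x
  have hKmem {r : Set (Set G)} (hr : IsGenericType δ r) {g : G} (hg : g ∈ K)
      (hgr : g • (H : Set G) ∈ r) : (K : Set G) ∈ r := by
    refine hr.1.mem_of_subset hgr (hK.1.2.2 _ hKclass) ?_
    rintro _ ⟨h, hh, rfl⟩
    exact K.mul_mem hg (hHK hh)
  obtain rfl : p = q :=
    (hK.2.2 p q hp hq).2 ⟨K, hKclass, hKmem hp K.one_mem hHp, hKmem hq hx hxq⟩
  obtain ⟨W, rfl⟩ := hp.1.exists_ultrafilter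
  obtain ⟨y, hy, hxy⟩ := Ultrafilter.nonempty_of_mem (inter_mem hHp.2 hxq.2)
  rw [one_smul] at hy
  rw [mem_leftCoset_iff, SetLike.mem_coe] at hxy
  simpa using H.mul_mem hy (H.inv_mem hxy)

theorem IsComponent.eq_leftRel (hH : IsComponent δ H) (hδ : HasDoubleLimits δ)
    (hinv : IsInvariantRel G δ) {E : Setoid G} (hE : IsEDelta δ E) :
    E = QuotientGroup.leftRel H := by
  obtain ⟨K, rfl⟩ := exists_eq_leftRel hE.2.1
  have hHK : H ≤ K := hH.2 ⟨finiteIndex_of_finite_classes hE.1.2.1,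
    hE.1.2.2 _ (classes_leftRel K ▸ ⟨1, one_smul _ _⟩)⟩
  rw [(hH.le_of_isEDelta hδ hinv hHK hE).antisymm hHK]

end EDelta

theorem theorem2p3_general {G : Type*} [Group G] {n : ℕ} (δ : G → (Fin n → G) → Prop)
    (hδ : HasDoubleLimits δ) (hinv : IsLeftInvariantRel δ) :
    (∃! E : Setoid G, IsEDelta δ E) ∧
    ∀ E : Setoid G, IsEDelta δ E →
      ∃ G0 : Subgroup G, (G0 : Set G) = identityClass E ∧
        (G0.FiniteIndex ∧ (G0 : Set G) ∈ DefAlg δ ∧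
          E.classes = Set.range fun g : G => g • (G0 : Set G)) ∧
        (∀ g : G, ∃! p : Set (Set G), IsGenericType δ p ∧ g • (G0 : Set G) ∈ p) ∧
        (∀ φ ∈ DefAlg δ, ∀ g : G,
          Xor (IsGeneric ((g • (G0 : Set G)) ∩ φ)) (IsGeneric ((g • (G0 : Set G)) \ φ))) ∧
        (∀ φ ∈ DefAlg δ, ¬ IsGeneric (symmDiff φ
          (⋃₀ {C : Set G | (∃ g : G, C = g • (G0 : Set G)) ∧ IsGeneric (C ∩ φ)}))) ∧
        (∀ H : Subgroup G, H.FiniteIndex → (H : Set G) ∈ DefAlg δ → G0 ≤ H) ∧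
        (∃! μ : DefAlg δ → ℝ, IsKeislerMeasure δ μ ∧ IsLeftInvariantMeasure δ μ) ∧
        (∀ μ : DefAlg δ → ℝ, IsKeislerMeasure δ μ → IsLeftInvariantMeasure δ μ →
          ∀ φ : DefAlg δ, 0 < μ φ ↔ IsGeneric (φ : Set G)) := by
  have hinv' : IsInvariantRel G δ := fun g b => hinv b g
  obtain ⟨H, hH⟩ := hδ.exists_isComponent hinv'
  refine ⟨⟨_, hH.isEDelta hδ hinv', fun E hE => hH.eq_leftRel hδ hinv' hE⟩, fun E hE => ?_⟩
  obtain rfl := hH.eq_leftRel hδ hinv' hE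
  exact ⟨H, (identityClass_leftRel H).symm, ⟨hH.1.1, hH.1.2, classes_leftRel H⟩,
    hH.existsUnique_isGenericType hδ hinv', fun A hA g => hH.xor_isGeneric hδ hinv' hA g,
    fun A hA => hH.not_isGeneric_symmDiff hδ hinv' hA, fun K hK hKδ => hH.2 ⟨hK, hKδ⟩,
    hH.existsUnique_keislerMeasure hδ hinv', fun μ hμ hμ' A => hμ.pos_iff hμ' hδ hinv' A⟩

end LocalStable

open LocalStable in
theorem theorem2p3 {G : Type*} [Group G] {n : ℕ} (δ : G → (Fin n → G) → Prop)
    (hstable : IsStable δ) (hinv : IsLeftInvariantRel δ) :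
    -- the relation `E_δ` exists and is unique, so that `G⁰_δ` is well defined
    (∃! E : Setoid G, IsEDelta δ E) ∧
    ∀ E : Setoid G, IsEDelta δ E →
      ∃ G0 : Subgroup G, (G0 : Set G) = identityClass E ∧
        -- (i)
        (G0.FiniteIndex ∧ (G0 : Set G) ∈ DefAlg δ ∧
          E.classes = Set.range fun g : G => g • (G0 : Set G)) ∧
        -- (ii)
        (∀ g : G, ∃! p : Set (Set G), IsGenericType δ p ∧ g • (G0 : Set G) ∈ p) ∧
        -- (iii)
        (∀ φ ∈ DefAlg δ, ∀ g : G,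
          Xor (IsGeneric ((g • (G0 : Set G)) ∩ φ)) (IsGeneric ((g • (G0 : Set G)) \ φ))) ∧
        -- (iv)
        (∀ φ ∈ DefAlg δ, ¬ IsGeneric (symmDiff φ
          (⋃₀ {C : Set G | (∃ g : G, C = g • (G0 : Set G)) ∧ IsGeneric (C ∩ φ)}))) ∧
        -- (v)
        (∀ H : Subgroup G, H.FiniteIndex → (H : Set G) ∈ DefAlg δ → G0 ≤ H) ∧
        -- (vi)
        (∃! μ : DefAlg δ → ℝ, IsKeislerMeasure δ μ ∧ IsLeftInvariantMeasure δ μ) ∧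
        (∀ μ : DefAlg δ → ℝ, IsKeislerMeasure δ μ → IsLeftInvariantMeasure δ μ →
          ∀ φ : DefAlg δ, 0 < μ φ ↔ IsGeneric (φ : Set G)) := by
  exact theorem2p3_general δ hstable.hasDoubleLimits hinv
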